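/- Let $I:[0,\infty)\to[0,1]$ be non-decreasing, and let $0<\alpha<1$, $c>0$ and $\theta_0\in\,]0,\pi/2[\,$. For measurable controls $\theta:[0,\infty)\to[\theta_0,\pi/2]$ (orientation of the stem) and $u:[0,\infty)\to[0,\infty)$ (density of leaves), put $$y(t)=\int_0^t\sin\theta(s)\,ds,\qquad z(t)=\int_t^{+\infty}u(s)\,ds,\qquad G(\theta,u)=\Big(1-\exp\Big\{\frac{-u}{\cos(\theta-\theta_0)}\Big\}\Big)\cos(\theta-\theta_0),$$ and assume that $z(t)\to 0$ as $t\to+\infty$. Consider the problem **(OP2)** maximize $\displaystyle\int_0^{+\infty}I(y(t))\,G(\theta(t),u(t))\,dt-c\int_0^{+\infty}z(t)^\alpha\,dt$ over all such pairs $(\theta,u)$ (the value is $-\infty$ if the second integral diverges). Then (OP2) has at least one solution $(\theta,u)$, and it can be chosen with $\int_0^{+\infty}u\,dt<\infty$. Moreover, optimal leaf measures are absolutely continuous, in the following sense. For a stem $\gamma(t)=\big(\int_0^t\cos\theta\,ds,\int_0^t\sin\theta\,ds\big)$ carrying an arbitrary finite Borel measure $\nu$ of leaves on the arc-length parameter $t\in\,]0,\infty[\,$,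 define the payoff by the same formula, with $z(t)=\nu(]t,\infty[)$ and with $u$ the density of the absolutely continuous part of $\nu$ with respect to Lebesgue measure. Then the solution $(\theta,u)$ above can be chosen so that $(\theta,u\,dt)$ is optimal also in this larger class, and for every pair $(\theta,\nu)$ which is optimal in this class the leaf measure $\mu(A)=\nu(\{t>0:\gamma(t)\in A\})$ in the plane is absolutely continuous with respect to the arc-length measure on $\gamma$. In particular, this holds for the leaf measure $\mu(A)=\int_{\gamma(t)\in A}u(t)\,dt$ of the solution above. -/

import Mathlib

open MeasureTheory Set Filter
open scoped ENNReal Topology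

noncomputable section

namespace StemModel

/-- Admissible orientation controls `θ : ℝ₊ → [θ₀, π/2]` (Lebesgue measurable).
Only the values on the half line `[0, ∞)` matter. -/
structure IsAngleControl (θ₀ : ℝ) (θ : ℝ → ℝ) : Prop where
  aemeasurable : AEMeasurable θ (volume.restrict (Ioi 0))
  mem_Icc : ∀ t, 0 ≤ t → θ t ∈ Icc θ₀ (Real.pi / 2)

/-- Height of the stem: the solution of `y' = sin θ`, `y(0) = 0`. -/
def height (θ : ℝ → ℝ) (t : ℝ) : ℝ := ∫ s in (0 : ℝ)..t, Real.sin (θ s)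

/-- Arc-length parameterization of the stem, `γ' = (cos θ, sin θ)`, `γ(0) = 0`. -/
def stem (θ : ℝ → ℝ) (t : ℝ) : EuclideanSpace ℝ (Fin 2) :=
  !₂[∫ s in (0 : ℝ)..t, Real.cos (θ s), height θ t]

/-- Arc-length measure on the stem: one-dimensional Hausdorff measure on the curve `γ([0, ∞))`. -/
def arcLength (θ : ℝ → ℝ) : Measure (EuclideanSpace ℝ (Fin 2)) :=
  (Measure.hausdorffMeasure 1).restrict (stem θ '' Ici 0)

/-- `G(θ, u) = (1 - exp(-u / cos(θ - θ₀))) cos(θ - θ₀)`. -/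
def gain (θ₀ θ u : ℝ) : ℝ :=
  (1 - Real.exp (-u / Real.cos (θ - θ₀))) * Real.cos (θ - θ₀)

/-- Sunlight gathered by leaves of density `u` along the stem, `∫₀^∞ I(y(t)) G(θ(t), u(t)) dt`.
The integrand is nonnegative for the controls considered here. -/
def sunlight (I : ℝ → ℝ) (θ₀ : ℝ) (θ u : ℝ → ℝ) : ℝ≥0∞ :=
  ∫⁻ t in Ioi 0, ENNReal.ofReal (I (height θ t) * gain θ₀ (θ t) (u t))

/-- Ramified irrigation cost `∫₀^∞ z(t)^α dt`, where `z(t)` is the leaf mass beyond `t`. -/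
def irrigationCost (α : ℝ) (z : ℝ → ℝ≥0∞) : ℝ≥0∞ := ∫⁻ t in Ioi 0, z t ^ α

/-- Sunlight minus `c` times the irrigation cost (it is `-∞` if the cost is infinite). -/
def payoff (I : ℝ → ℝ) (α c θ₀ : ℝ) (θ u : ℝ → ℝ) (z : ℝ → ℝ≥0∞) : EReal :=
  (sunlight I θ₀ θ u : EReal) - ((ENNReal.ofReal c * irrigationCost α z : ℝ≥0∞) : EReal)

/-! ### Leaf densities -/

/-- `z(t) = ∫_t^∞ u(s) ds`. -/
def massBeyond (u : ℝ → ℝ) (t : ℝ) : ℝ≥0∞ := ∫⁻ s in Ioi t, ENNReal.ofReal (u s)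

/-- Admissible leaf densities: measurable `u : ℝ₊ → ℝ₊` for which the solution `z` of `z' = -u`,
`z(+∞) = 0` exists. (The leaf mass near the root is allowed to be infinite.) -/
structure IsDensityControl (u : ℝ → ℝ) : Prop where
  aemeasurable : AEMeasurable u (volume.restrict (Ioi 0))
  nonneg : ∀ t, 0 ≤ t → 0 ≤ u t
  tendsto_massBeyond : Tendsto (massBeyond u) atTop (𝓝 0)

/-- `(θ, u)` solves (OP2): it is admissible, and it maximizes
`∫₀^∞ [I(y) G(θ, u) - c z^α] dt` among all admissible pairs of controls. -/
structure IsSolutionOP2 (I : ℝ → ℝ) (α c θ₀ : ℝ) (θ u : ℝ → ℝ) : Prop where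
  angle : IsAngleControl θ₀ θ
  density : IsDensityControl u
  maximal : ∀ θ' u' : ℝ → ℝ, IsAngleControl θ₀ θ' → IsDensityControl u' →
    payoff I α c θ₀ θ' u' (massBeyond u') ≤ payoff I α c θ₀ θ u (massBeyond u)

/-! ### General leaf measures

A leaf measure on the stem is described through the arc-length parameter, by a measure `ν` on
`(0, ∞)` (only the restriction of `ν` to `(0, ∞)` is ever used). Its irrigation cost is computed
from the tails `z(t) = ν((t, ∞))`, while only the density of its absolutely continuous part
gathers sunlight. -/

/-- The payoff of a general leaf measure. -/
def measurePayoff (I : ℝ → ℝ) (α c θ₀ : ℝ) (θ : ℝ → ℝ) (ν : Measure ℝ) : EReal :=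
  payoff I α c θ₀ θ (fun t => (ν.rnDeriv volume t).toReal) (fun t => ν (Ioi t))

/-- `(θ, ν)` is optimal among all stems carrying an arbitrary finite leaf measure. -/
structure IsOptimalLeafMeasure (I : ℝ → ℝ) (α c θ₀ : ℝ) (θ : ℝ → ℝ) (ν : Measure ℝ) : Prop where
  angle : IsAngleControl θ₀ θ
  finite : IsFiniteMeasure ν
  maximal : ∀ (θ' : ℝ → ℝ) (ν' : Measure ℝ), IsAngleControl θ₀ θ' → IsFiniteMeasure ν' →
    measurePayoff I α c θ₀ θ' ν' ≤ measurePayoff I α c θ₀ θ ν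

/-- The measure on the arc-length parameter with density `u`. -/
def densityMeasure (u : ℝ → ℝ) : Measure ℝ :=
  (volume.restrict (Ioi 0)).withDensity fun t => ENNReal.ofReal (u t)

/-- The leaf measure in the plane, `μ(A) = ν {t > 0 | γ(t) ∈ A}`. For `ν = densityMeasure u` this
is `μ(A) = ∫_{γ(t) ∈ A} u(t) dt`. -/
def planarLeafMeasure (θ : ℝ → ℝ) (ν : Measure ℝ) : Measure (EuclideanSpace ℝ (Fin 2)) :=
  (ν.restrict (Ioi 0)).map (stem θ)

end StemModel

end

noncomputable section

namespace StemModel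

section

/-! ### The gain function -/

/-! The existence proof is the direct method, after a reduction that restores compactness. With `p =
cos (θ - θ₀)` the gain is the perspective `p (1 - exp (-u / p))`: jointly concave in `(p, u)`,
nondecreasing in `p`, below all its tangent planes (`gain_le_slope`).

Reduction: a nonnegative payoff bounds the irrigation cost by a constant `C`, hence `z t ≤ (C / t) ^
α⁻¹`. Concavity of `z ^ α` then makes the marginal cost of a leaf at distance `s` at least `K * s ^
α⁻¹`, with `K = capCoeff α c`, while its marginal gain at density `u` is at most `exp (-u)`. Leaves
in excess of `cap α c` can be removed without loss (`payoff_le_payoff_truncate`). The cap has only a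
logarithmic singularity at the root and vanishes far out, so capped densities are bounded in `L²` of
a bounded interval.

Limit: along a maximizing sequence, `sin θₙ`, `cos θₙ` and `uₙ` converge weakly. The limit `(v, w)`
of `(cos θₙ, sin θₙ)` lies in the unit disc; the angle `arcsin w` keeps the limit heights and can
only increase `p` (`exists_limit_control`). Costs converge, and sunlight is upper semicontinuous by
the tangent plane at the limit (`exists_sunlight_bound`).

For measures, the singular part gathers no light but strictly raises a finite cost
(`irrigationCost_rnDeriv_lt`), so optimal measures have a density in `t`. The height grows at rate
at least `sin θ₀`, so the stem is antilipschitz and this passes to arc length in the plane. -/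

/-- The slope `1 - e⁻ˣ - x e⁻ˣ` of the perspective function `(p, u) ↦ p (1 - exp (-u / p))` in
the direction `p`, where `x = u / p`. -/
def slope (x : ℝ) : ℝ := 1 - Real.exp (-x) - x * Real.exp (-x)

lemma slope_nonneg (x : ℝ) : 0 ≤ slope x := by
  have h := Real.add_one_le_exp x
  have h1 : Real.exp (-x) * Real.exp x = 1 := by rw [← Real.exp_add]; simp
  have h2 := mul_le_mul_of_nonneg_left h (Real.exp_pos (-x)).le
  unfold slope
  nlinarith

lemma slope_le_one {x : ℝ} (hx : 0 ≤ x) : slope x ≤ 1 := by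
  have h := Real.exp_pos (-x)
  have := mul_nonneg hx h.le
  unfold slope
  linarith

lemma measurable_slope : Measurable slope := by
  unfold slope
  fun_prop

lemma perspective_eq {p : ℝ} (hp : 0 < p) (u : ℝ) :
    (1 - Real.exp (-u / p)) * p = slope (u / p) * p + Real.exp (-(u / p)) * u := by
  unfold slope
  rw [neg_div]
  field_simp
  ring

/-- This is the tangent plane along the ray `u / p = x`; homogeneity of degree one removes the
constant term. The estimate is `1 + y ≤ exp y` at `y = x - u / p`. -/
lemma perspective_le {p : ℝ} (hp : 0 < p) (u x : ℝ) :
    (1 - Real.exp (-u / p)) * p ≤ slope x * p + Real.exp (-x) * u := by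
  have h1 := Real.add_one_le_exp (x - u / p)
  have h2 : Real.exp (-u / p) = Real.exp (-x) * Real.exp (x - u / p) := by
    rw [← Real.exp_add]; congr 1; ring
  have h3 : Real.exp (-x) * (x - u / p + 1) ≤ Real.exp (-u / p) := by
    rw [h2]; exact mul_le_mul_of_nonneg_left h1 (Real.exp_pos _).le
  have h4 := mul_le_mul_of_nonneg_right h3 hp.le
  have h5 : u / p * p = u := div_mul_cancel₀ _ hp.ne'
  have h6 : Real.exp (-x) * (x - u / p + 1) * p
      = Real.exp (-x) * (x * p + p) - Real.exp (-x) * u := by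
    rw [← h5]; field_simp; ring
  unfold slope
  nlinarith

variable {θ₀ : ℝ}

lemma cos_sub_pos (hθ₀ : θ₀ ∈ Ioo 0 (Real.pi / 2)) {x : ℝ} (hx : x ∈ Icc θ₀ (Real.pi / 2)) :
    0 < Real.cos (x - θ₀) :=
  Real.cos_pos_of_mem_Ioo ⟨by linarith [hx.1, Real.pi_pos], by linarith [hx.2, hθ₀.1]⟩

lemma gain_eq_slope (hθ₀ : θ₀ ∈ Ioo 0 (Real.pi / 2)) {x : ℝ} (hx : x ∈ Icc θ₀ (Real.pi / 2))
    (u : ℝ) :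
    gain θ₀ x u = slope (u / Real.cos (x - θ₀)) * Real.cos (x - θ₀)
      + Real.exp (-(u / Real.cos (x - θ₀))) * u :=
  perspective_eq (cos_sub_pos hθ₀ hx) u

lemma gain_le_slope (hθ₀ : θ₀ ∈ Ioo 0 (Real.pi / 2)) {x : ℝ} (hx : x ∈ Icc θ₀ (Real.pi / 2))
    (u a : ℝ) :
    gain θ₀ x u ≤ slope a * Real.cos (x - θ₀) + Real.exp (-a) * u :=
  perspective_le (cos_sub_pos hθ₀ hx) u a

lemma gain_nonneg (hθ₀ : θ₀ ∈ Ioo 0 (Real.pi / 2)) {x : ℝ} (hx : x ∈ Icc θ₀ (Real.pi / 2))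
    {u : ℝ} (hu : 0 ≤ u) : 0 ≤ gain θ₀ x u := by
  have hp := cos_sub_pos hθ₀ hx
  refine mul_nonneg (sub_nonneg.2 (Real.exp_le_one_iff.2 ?_)) hp.le
  rw [neg_div]
  exact neg_nonpos.2 (by positivity)

lemma gain_le_one (hθ₀ : θ₀ ∈ Ioo 0 (Real.pi / 2)) {x : ℝ} (hx : x ∈ Icc θ₀ (Real.pi / 2))
    (u : ℝ) : gain θ₀ x u ≤ 1 := by
  have hp := cos_sub_pos hθ₀ hx
  have h1 := Real.cos_le_one (x - θ₀)
  have h2 := Real.exp_pos (-u / Real.cos (x - θ₀))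
  unfold gain
  nlinarith

lemma gain_le_self (hθ₀ : θ₀ ∈ Ioo 0 (Real.pi / 2)) {x : ℝ} (hx : x ∈ Icc θ₀ (Real.pi / 2))
    (u : ℝ) : gain θ₀ x u ≤ u := by
  simpa [slope] using gain_le_slope hθ₀ hx u 0

lemma gain_zero (θ₀ x : ℝ) : gain θ₀ x 0 = 0 := by simp [gain]

/-- The derivative of the gain in the density at `v` is `exp (-v / p)` with `p ≤ 1`, which gives a
bound free of the angle. -/
lemma gain_le_add (hθ₀ : θ₀ ∈ Ioo 0 (Real.pi / 2)) {x : ℝ} (hx : x ∈ Icc θ₀ (Real.pi / 2))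
    {u v : ℝ} (hv : 0 ≤ v) (huv : v ≤ u) :
    gain θ₀ x u ≤ gain θ₀ x v + Real.exp (-v) * (u - v) := by
  have hp := cos_sub_pos hθ₀ hx
  have h1 := gain_le_slope hθ₀ hx u (v / Real.cos (x - θ₀))
  have h2 := gain_eq_slope hθ₀ hx v
  have h3 : v ≤ v / Real.cos (x - θ₀) := le_div_self hv hp (Real.cos_le_one _)
  have h4 : Real.exp (-(v / Real.cos (x - θ₀))) ≤ Real.exp (-v) := Real.exp_le_exp.2 (by linarith)
  have h5 := mul_le_mul_of_nonneg_right h4 (sub_nonneg.2 huv)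
  linarith

end

/-! ### Weak convergence of square integrable functions -/

/-- Weak convergence in `L²(μ)`. -/
def WeakTendsto (μ : Measure ℝ) (f : ℕ → ℝ → ℝ) (g : ℝ → ℝ) : Prop :=
  ∀ h : ℝ → ℝ, MemLp h 2 μ →
    Tendsto (fun n => ∫ t, h t * f n t ∂μ) atTop (𝓝 (∫ t, h t * g t ∂μ))

/-- Domination by `k` bounds the `L²` norms; sequential Banach–Alaoglu in the dual is carried back
by the Riesz isometry. -/
lemma exists_weakTendsto_subseq {μ : Measure ℝ} [IsFiniteMeasure μ] {f : ℕ → ℝ → ℝ} {k : ℝ → ℝ}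
    (hk : MemLp k 2 μ) (hf : ∀ n, AEStronglyMeasurable (f n) μ)
    (hfk : ∀ n, ∀ᵐ t ∂μ, |f n t| ≤ k t) :
    ∃ φ : ℕ → ℕ, StrictMono φ ∧ ∃ g : ℝ → ℝ, Measurable g ∧ MemLp g 2 μ ∧
      WeakTendsto μ (fun n => f (φ n)) g := by
  have hmem : ∀ n, MemLp (f n) 2 μ := fun n => hk.mono' (hf n) (by simpa using hfk n)
  set F : ℕ → Lp ℝ 2 μ := fun n => (hmem n).toLp (f n) with hF
  have hbound : ∀ n, ‖F n‖ ≤ ‖hk.toLp k‖ := by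
    intro n
    refine Lp.norm_le_norm_of_ae_le ?_
    filter_upwards [(hmem n).coeFn_toLp, hk.coeFn_toLp, hfk n] with t h1 h2 h3
    rw [h1, h2, Real.norm_eq_abs, Real.norm_eq_abs]
    exact h3.trans (le_abs_self _)
  -- This gives separability of `L²`, hence sequential compactness of the weak-* ball.
  have : Fact ((2 : ℝ≥0∞) ≠ ∞) := ⟨ENNReal.ofNat_ne_top⟩
  have hseq := WeakDual.isSeqCompact_closedBall ℝ (Lp ℝ 2 μ) 0 ‖hk.toLp k‖
  set D : ℕ → WeakDual ℝ (Lp ℝ 2 μ) :=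
    fun n => StrongDual.toWeakDual (InnerProductSpace.toDual ℝ (Lp ℝ 2 μ) (F n)) with hD
  obtain ⟨L, -, φ, hφ, hL⟩ := hseq (x := D) (fun n => by
    simp only [hD, mem_preimage, mem_closedBall_zero_iff]
    exact (LinearIsometryEquiv.norm_map (InnerProductSpace.toDual ℝ (Lp ℝ 2 μ)) (F n)).trans_le
      (hbound n))
  set G : Lp ℝ 2 μ := (InnerProductSpace.toDual ℝ (Lp ℝ 2 μ)).symm (WeakDual.toStrongDual L) with hG
  refine ⟨φ, hφ, G, (Lp.stronglyMeasurable G).measurable, Lp.memLp G, fun h hh => ?_⟩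
  have h1 := ((WeakDual.eval_continuous (𝕜 := ℝ) (hh.toLp h)).tendsto L).comp hL
  have h2 : ∀ n, D n (hh.toLp h) = ∫ t, h t * f n t ∂μ := by
    intro n
    change inner ℝ (F n) (hh.toLp h) = _
    rw [L2.inner_def]
    refine integral_congr_ae ?_
    filter_upwards [(hmem n).coeFn_toLp, hh.coeFn_toLp] with t h1 h2
    rw [h1, h2]; simp
  have h3 : L (hh.toLp h) = ∫ t, h t * G t ∂μ := by
    have : L (hh.toLp h) = inner ℝ G (hh.toLp h) := by
      rw [hG, InnerProductSpace.toDual_symm_apply]; rfl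
    rw [this, L2.inner_def]
    refine integral_congr_ae ?_
    filter_upwards [hh.coeFn_toLp] with t h2
    rw [h2]; simp
  rw [h3] at h1
  refine h1.congr fun n => ?_
  exact h2 (φ n)

namespace WeakTendsto

variable {μ : Measure ℝ} {f f' : ℕ → ℝ → ℝ} {g g' : ℝ → ℝ}

lemma comp (h : WeakTendsto μ f g) {φ : ℕ → ℕ} (hφ : StrictMono φ) :
    WeakTendsto μ (fun n => f (φ n)) g :=
  fun k hk => (h k hk).comp hφ.tendsto_atTop

lemma congr_right (h : WeakTendsto μ f g) (hg : g =ᵐ[μ] g') : WeakTendsto μ f g' := by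
  intro k hk
  have : ∫ t, k t * g' t ∂μ = ∫ t, k t * g t ∂μ := by
    refine integral_congr_ae ?_
    filter_upwards [hg] with t ht
    rw [ht]
  rw [this]
  exact h k hk

lemma add (hf : WeakTendsto μ f g) (hf' : WeakTendsto μ f' g') (h1 : ∀ n, MemLp (f n) 2 μ)
    (h2 : ∀ n, MemLp (f' n) 2 μ) (h3 : MemLp g 2 μ) (h4 : MemLp g' 2 μ) :
    WeakTendsto μ (fun n t => f n t + f' n t) (fun t => g t + g' t) := by
  intro k hk
  simp only [mul_add]
  have key : ∀ {v w : ℝ → ℝ}, MemLp v 2 μ → MemLp w 2 μ →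
      ∫ t, (k t * v t + k t * w t) ∂μ = ∫ t, k t * v t ∂μ + ∫ t, k t * w t ∂μ :=
    fun hv hw => integral_add (hk.integrable_mul hv) (hk.integrable_mul hw)
  rw [key h3 h4]
  exact ((hf k hk).add (hf' k hk)).congr fun n => (key (h1 n) (h2 n)).symm

lemma bdd_mul (hf : WeakTendsto μ f g) {a : ℝ → ℝ} {C : ℝ} (ha : AEStronglyMeasurable a μ)
    (haC : ∀ᵐ t ∂μ, |a t| ≤ C) :
    WeakTendsto μ (fun n t => a t * f n t) (fun t => a t * g t) := by
  intro k hk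
  have hka : MemLp (fun t => k t * a t) 2 μ := by
    refine (hk.const_mul C).mono (hk.aestronglyMeasurable.mul ha) ?_
    filter_upwards [haC] with t ht
    rw [norm_mul, norm_mul, mul_comm]
    exact mul_le_mul_of_nonneg_right (ht.trans (le_abs_self _)) (norm_nonneg _)
  simpa only [mul_assoc] using hf _ hka

/-- Indicators of measurable sets are test functions, so the inequality of set integrals passes to
the limit. -/
lemma ae_le [IsFiniteMeasure μ] (hf : WeakTendsto μ f g) (h1 : ∀ n, MemLp (f n) 2 μ)
    (h2 : MemLp g 2 μ) {k : ℝ → ℝ} (hk : Integrable k μ) (hfk : ∀ n, ∀ᵐ t ∂μ, f n t ≤ k t) :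
    ∀ᵐ t ∂μ, g t ≤ k t := by
  refine ae_le_of_forall_setIntegral_le (h2.integrable (by norm_num)) hk fun s hs _ => ?_
  have hs2 : MemLp (s.indicator fun _ => (1 : ℝ)) 2 μ := (memLp_const (1 : ℝ)).indicator hs
  have key : ∀ v : ℝ → ℝ, ∫ t, s.indicator (fun _ => (1 : ℝ)) t * v t ∂μ = ∫ t in s, v t ∂μ := by
    intro v
    rw [← integral_indicator hs]
    refine integral_congr_ae (Eventually.of_forall fun t => ?_)
    by_cases ht : t ∈ s <;> simp [ht]
  have h3 := hf _ hs2
  simp only [key] at h3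
  refine le_of_tendsto' h3 fun n => ?_
  refine integral_mono_ae ((h1 n).integrable (by norm_num)).integrableOn hk.integrableOn ?_
  exact ae_restrict_of_ae (hfk n)

lemma ae_ge [IsFiniteMeasure μ] (hf : WeakTendsto μ f g) (h1 : ∀ n, MemLp (f n) 2 μ)
    (h2 : MemLp g 2 μ) {k : ℝ → ℝ} (hk : Integrable k μ) (hfk : ∀ n, ∀ᵐ t ∂μ, k t ≤ f n t) :
    ∀ᵐ t ∂μ, k t ≤ g t := by
  have h : WeakTendsto μ (fun n t => - f n t) (fun t => - g t) := by
    intro v hv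
    simpa only [mul_neg, integral_neg] using (hf v hv).neg
  have h3 := h.ae_le (fun n => (h1 n).neg) h2.neg hk.neg
    (fun n => (hfk n).mono fun t ht => neg_le_neg ht)
  exact h3.mono fun t ht => neg_le_neg_iff.1 ht

end WeakTendsto

section

/-! ### The stem -/

namespace IsAngleControl

variable {θ₀ : ℝ} {θ : ℝ → ℝ}

lemma aemeasurable_restrict (h : IsAngleControl θ₀ θ) {s : Set ℝ} (hs : s ⊆ Ioi 0) :
    AEMeasurable θ (volume.restrict s) :=
  h.aemeasurable.mono_measure (Measure.restrict_mono hs le_rfl)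

lemma sin_mem (h : IsAngleControl θ₀ θ) (hθ₀ : θ₀ ∈ Ioo 0 (Real.pi / 2)) {t : ℝ} (ht : 0 ≤ t) :
    Real.sin (θ t) ∈ Icc (Real.sin θ₀) 1 :=
  ⟨Real.sin_le_sin_of_le_of_le_pi_div_two (by linarith [hθ₀.1, Real.pi_pos]) (h.mem_Icc t ht).2
    (h.mem_Icc t ht).1, Real.sin_le_one _⟩

lemma intervalIntegrable_sin (h : IsAngleControl θ₀ θ) {s t : ℝ} (hs : 0 ≤ s) (hst : s ≤ t) :
    IntervalIntegrable (fun r => Real.sin (θ r)) volume s t := by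
  rw [intervalIntegrable_iff_integrableOn_Ioc_of_le hst]
  refine Integrable.of_bound (C := 1) ?_ (Eventually.of_forall fun r => Real.abs_sin_le_one _)
  exact (Real.measurable_sin.comp_aemeasurable
    (h.aemeasurable_restrict fun r hr => hs.trans_lt hr.1)).aestronglyMeasurable

lemma height_sub (h : IsAngleControl θ₀ θ) {s t : ℝ} (hs : 0 ≤ s) (hst : s ≤ t) :
    height θ t - height θ s = ∫ r in s..t, Real.sin (θ r) :=
  intervalIntegral.integral_interval_sub_left (h.intervalIntegrable_sin le_rfl (hs.trans hst))
    (h.intervalIntegrable_sin le_rfl hs)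

lemma le_height_sub (h : IsAngleControl θ₀ θ) (hθ₀ : θ₀ ∈ Ioo 0 (Real.pi / 2)) {s t : ℝ}
    (hs : 0 ≤ s) (hst : s ≤ t) :
    Real.sin θ₀ * (t - s) ≤ height θ t - height θ s := by
  rw [h.height_sub hs hst]
  have := intervalIntegral.integral_mono_on (μ := volume) hst
    (intervalIntegrable_const (c := Real.sin θ₀)) (h.intervalIntegrable_sin hs hst)
    (fun r hr => (h.sin_mem hθ₀ (hs.trans hr.1)).1)
  simpa [mul_comm] using this

lemma sin_pos (hθ₀ : θ₀ ∈ Ioo 0 (Real.pi / 2)) : 0 < Real.sin θ₀ :=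
  Real.sin_pos_of_pos_of_lt_pi hθ₀.1 (by linarith [hθ₀.2, Real.pi_pos])

lemma strictMonoOn_height (h : IsAngleControl θ₀ θ) (hθ₀ : θ₀ ∈ Ioo 0 (Real.pi / 2)) :
    StrictMonoOn (height θ) (Ici 0) := by
  intro s hs t _ hst
  have h1 := h.le_height_sub hθ₀ hs hst.le
  have h2 := mul_pos (sin_pos hθ₀) (sub_pos.2 hst)
  linarith

lemma height_nonneg (h : IsAngleControl θ₀ θ) (hθ₀ : θ₀ ∈ Ioo 0 (Real.pi / 2)) {t : ℝ}
    (ht : 0 ≤ t) : 0 ≤ height θ t := by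
  have h1 := (h.strictMonoOn_height hθ₀).monotoneOn self_mem_Ici ht ht
  simpa [height] using h1

/-- The vertical coordinate alone separates points, since `sin θ ≥ sin θ₀ > 0`. -/
lemma antilipschitzWith_stem (h : IsAngleControl θ₀ θ) (hθ₀ : θ₀ ∈ Ioo 0 (Real.pi / 2)) :
    AntilipschitzWith (Real.toNNReal (Real.sin θ₀)⁻¹) (fun t : Ici (0 : ℝ) => stem θ t) := by
  have hpos := sin_pos hθ₀
  have key : ∀ s t : ℝ, 0 ≤ s → s ≤ t → t - s ≤ (Real.sin θ₀)⁻¹ * dist (stem θ s) (stem θ t) := by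
    intro s t hs hst
    have h1 := h.le_height_sub hθ₀ hs hst
    have h2 := PiLp.norm_apply_le (stem θ t - stem θ s) (1 : Fin 2)
    have h3 : (stem θ t - stem θ s) (1 : Fin 2) = height θ t - height θ s := by simp [stem]
    rw [h3, Real.norm_eq_abs, ← dist_eq_norm, dist_comm] at h2
    have h4 := (le_abs_self _).trans h2
    rw [inv_mul_eq_div, le_div_iff₀ hpos]
    linarith
  refine AntilipschitzWith.of_le_mul_dist fun s t => ?_
  rw [Real.coe_toNNReal _ (inv_nonneg.2 hpos.le), Subtype.dist_eq, Real.dist_eq]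
  rcases le_total (s : ℝ) t with hst | hst
  · rw [abs_sub_comm, abs_of_nonneg (sub_nonneg.2 hst)]
    exact key s t s.2 hst
  · rw [abs_of_nonneg (sub_nonneg.2 hst), dist_comm]
    exact key t s t.2 hst

/-- A leaf measure with a density with respect to the arc-length parameter has a density with
respect to the arc-length measure. -/
lemma planarLeafMeasure_absolutelyContinuous (h : IsAngleControl θ₀ θ)
    (hθ₀ : θ₀ ∈ Ioo 0 (Real.pi / 2)) {ν : Measure ℝ} (hν : ν.restrict (Ioi 0) ≪ volume) :
    planarLeafMeasure θ ν ≪ arcLength θ := by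
  refine Measure.AbsolutelyContinuous.mk fun A hA hA0 => ?_
  unfold planarLeafMeasure
  -- A pushforward along a map that is not a.e. measurable is zero by convention, so measurability
  -- of the stem need not be proved.
  by_cases hm : AEMeasurable (stem θ) (ν.restrict (Ioi 0))
  swap
  · simp [Measure.map_of_not_aemeasurable hm]
  rw [Measure.map_apply_of_aemeasurable hm hA]
  -- Preimages under an antilipschitz map of null sets for the one-dimensional Hausdorff measure are
  -- null, and on the line that measure is Lebesgue measure.
  have h0 : volume (Subtype.val '' ((fun t : Ici (0 : ℝ) => stem θ t) ⁻¹' A)) = 0 := by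
    rw [← hausdorffMeasure_real, isometry_subtype_coe.hausdorffMeasure_image (Or.inl zero_le_one)]
    have h1 := (h.antilipschitzWith_stem hθ₀).hausdorffMeasure_preimage_le zero_le_one
      (A ∩ stem θ '' Ici 0)
    rw [arcLength, Measure.restrict_apply hA] at hA0
    rw [hA0, mul_zero, nonpos_iff_eq_zero] at h1
    refine measure_mono_null (fun t ht => ?_) h1
    exact ⟨ht, mem_image_of_mem _ t.2⟩
  have h2 : (ν.restrict (Ioi 0)) (Ioi 0)ᶜ = 0 := by
    rw [Measure.restrict_apply measurableSet_Ioi.compl, compl_inter_self, measure_empty]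
  refine measure_mono_null (t := Subtype.val '' ((fun t : Ici (0 : ℝ) => stem θ t) ⁻¹' A) ∪ (Ioi 0)ᶜ)
    (fun t ht => ?_) (measure_union_null (hν h0) h2)
  by_cases h3 : t ∈ Ioi (0 : ℝ)
  · exact Or.inl ⟨⟨t, Ioi_subset_Ici_self h3⟩, ht, rfl⟩
  · exact Or.inr h3

end IsAngleControl

end

/-! ### Comparison of payoffs -/

/-- Comparing cross sums avoids extended subtraction: only the costs must be finite, the sunlight
may be infinite. -/
lemma coe_sub_coe_le {a b a' b' : ℝ≥0∞} (hb : b ≠ ∞) (hb' : b' ≠ ∞) (h : a + b' ≤ a' + b) :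
    (a : EReal) - (b : EReal) ≤ (a' : EReal) - (b' : EReal) := by
  rcases eq_or_ne a' ∞ with rfl | ha'
  · rw [EReal.coe_ennreal_top, EReal.top_sub (by simpa using hb')]
    exact le_top
  have ha : a ≠ ∞ := ne_top_of_le_ne_top (ENNReal.add_ne_top.2 ⟨ha', hb⟩) (le_self_add.trans h)
  lift a to NNReal using ha
  lift a' to NNReal using ha'
  lift b to NNReal using hb
  lift b' to NNReal using hb'
  have h1 : (a : ℝ) + b' ≤ a' + b := by exact_mod_cast h
  have h2 : (a : ℝ) - b ≤ a' - b' := by linarith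
  simp only [EReal.coe_nnreal_eq_coe_real]
  exact_mod_cast h2

/-- In `EReal` the difference `⊤ - ⊤` is `⊥`, so an infinite cost is excluded even against infinite
sunlight. -/
lemma le_of_coe_sub_coe_nonneg {a b : ℝ≥0∞} (h : 0 ≤ (a : EReal) - (b : EReal)) :
    b ≤ a ∧ b ≠ ∞ := by
  have hb : b ≠ ∞ := by
    rintro rfl
    simp at h
  refine ⟨?_, hb⟩
  rw [EReal.sub_nonneg (Or.inr (by simpa using hb)) (Or.inr (by simp))] at h
  exact_mod_cast h

lemma payoff_zero_nonneg (I : ℝ → ℝ) {α : ℝ} (hα : 0 < α) (c θ₀ : ℝ) (θ u : ℝ → ℝ) :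
    0 ≤ payoff I α c θ₀ θ u (fun _ => 0) := by
  simpa [payoff, irrigationCost, ENNReal.zero_rpow_of_pos hα] using EReal.coe_ennreal_nonneg _

/-! ### A priori bounds -/

/-- The gain is at most `1`, used up to `T`, and at most `u`, used beyond `T`. -/
lemma sunlight_le {I : ℝ → ℝ} {θ₀ : ℝ} {θ u : ℝ → ℝ} (hθ₀ : θ₀ ∈ Ioo 0 (Real.pi / 2))
    (hI_mem : ∀ y, 0 ≤ y → I y ∈ Icc (0 : ℝ) 1) (hθ : IsAngleControl θ₀ θ)
    (hu : ∀ t, 0 ≤ t → 0 ≤ u t) {T : ℝ} (hT : 0 ≤ T) :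
    sunlight I θ₀ θ u ≤ ENNReal.ofReal T + massBeyond u T := by
  have key : ∀ t, 0 < t → I (height θ t) * gain θ₀ (θ t) (u t) ≤ gain θ₀ (θ t) (u t) := by
    intro t ht
    exact mul_le_of_le_one_left (gain_nonneg hθ₀ (hθ.mem_Icc t ht.le) (hu t ht.le))
      (hI_mem _ (hθ.height_nonneg hθ₀ ht.le)).2
  unfold sunlight massBeyond
  rw [← Ioc_union_Ioi_eq_Ioi hT]
  refine (lintegral_union_le _ _ _).trans (add_le_add ?_ ?_)
  · calc ∫⁻ t in Ioc 0 T, ENNReal.ofReal (I (height θ t) * gain θ₀ (θ t) (u t))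
        ≤ ∫⁻ _ in Ioc 0 T, 1 := by
          refine setLIntegral_mono measurable_const fun t ht => ?_
          rw [← ENNReal.ofReal_one]
          exact ENNReal.ofReal_le_ofReal
            ((key t ht.1).trans (gain_le_one hθ₀ (hθ.mem_Icc t ht.1.le) _))
      _ = ENNReal.ofReal T := by simp
  · refine setLIntegral_mono' measurableSet_Ioi fun t ht => ?_
    have ht0 : 0 < t := hT.trans_lt ht
    exact ENNReal.ofReal_le_ofReal
      ((key t ht0).trans (gain_le_self hθ₀ (hθ.mem_Icc t ht0.le) _))

lemma antitone_massBeyond (u : ℝ → ℝ) : Antitone (massBeyond u) :=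
  fun _ _ hst => lintegral_mono_set (Ioi_subset_Ioi hst)

/-- Chebyshev: the tails are antitone, so `T * z T ^ α` is at most the cost. -/
lemma tail_le_of_irrigationCost_le {α r T : ℝ} {z : ℝ → ℝ≥0∞} (hα : 0 < α) (hz : Antitone z)
    (hT : 0 < T) (h : irrigationCost α z ≤ ENNReal.ofReal r) :
    z T ≤ ENNReal.ofReal (r / T) ^ α⁻¹ := by
  rw [ENNReal.le_rpow_inv_iff hα, ENNReal.ofReal_div_of_pos hT,
    ENNReal.le_div_iff_mul_le (Or.inl (by simpa using hT)) (Or.inl ENNReal.ofReal_ne_top)]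
  refine le_trans ?_ h
  calc z T ^ α * ENNReal.ofReal T = ∫⁻ _ in Ioc 0 T, z T ^ α := by simp
    _ ≤ ∫⁻ t in Ioc 0 T, z t ^ α :=
        setLIntegral_mono' measurableSet_Ioc fun t ht => ENNReal.rpow_le_rpow (hz ht.2) hα.le
    _ ≤ irrigationCost α z := lintegral_mono_set Ioc_subset_Ioi_self

/-- A bound for the irrigation cost of every control with nonnegative payoff. -/
def costBound (α c : ℝ) : ℝ := 2 / c * (2 / c) ^ α⁻¹

lemma costBound_pos {α c : ℝ} (hc : 0 < c) : 0 < costBound α c := by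
  unfold costBound
  positivity

lemma irrigationCost_le_costBound {I : ℝ → ℝ} {α c θ₀ : ℝ} {θ u : ℝ → ℝ} (hα : 0 < α) (hc : 0 < c)
    (hθ₀ : θ₀ ∈ Ioo 0 (Real.pi / 2)) (hI_mem : ∀ y, 0 ≤ y → I y ∈ Icc (0 : ℝ) 1)
    (hθ : IsAngleControl θ₀ θ) (hu : ∀ t, 0 ≤ t → 0 ≤ u t)
    (h : 0 ≤ payoff I α c θ₀ θ u (massBeyond u)) :
    irrigationCost α (massBeyond u) ≤ ENNReal.ofReal (costBound α c) := by
  obtain ⟨h1, h2⟩ := le_of_coe_sub_coe_nonneg h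
  have hC : irrigationCost α (massBeyond u) ≠ ∞ := by
    intro h3
    rw [h3, ENNReal.mul_top (by simpa using hc)] at h2
    exact h2 rfl
  obtain ⟨r, hr0, hr⟩ : ∃ r : ℝ, 0 ≤ r ∧ irrigationCost α (massBeyond u) = ENNReal.ofReal r :=
    ⟨_, ENNReal.toReal_nonneg, (ENNReal.ofReal_toReal hC).symm⟩
  rw [hr]
  refine ENNReal.ofReal_le_ofReal ?_
  rcases hr0.eq_or_lt with rfl | hr0
  · exact (costBound_pos hc).le
  -- With `T = c * r / 2` the term `T` absorbs half of `c * r`, and the tail bound depends on `r / T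
  -- = 2 / c`, free of `r`.
  have hT : 0 < c * r / 2 := by positivity
  have h3 := tail_le_of_irrigationCost_le hα (antitone_massBeyond u) hT hr.le
  have h4 : r / (c * r / 2) = 2 / c := by field_simp
  rw [h4, ENNReal.ofReal_rpow_of_pos (by positivity)] at h3
  have h5 := h1.trans ((sunlight_le hθ₀ hI_mem hθ hu hT.le).trans (add_le_add_right h3 _))
  rw [hr, ← ENNReal.ofReal_mul hc.le, ← ENNReal.ofReal_add hT.le (by positivity),
    ENNReal.ofReal_le_ofReal_iff (by positivity)] at h5
  have h6 : c * r ≤ 2 * (2 / c) ^ α⁻¹ := by linarith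
  unfold costBound
  rw [div_mul_eq_mul_div, le_div_iff₀ hc]
  linarith

/-! ### Truncation of leaf densities -/

/-- Concavity of the power: the chord slope on `[x, y]` is at least the derivative at `y`, hence at
least that at `b`. The first bound is Bernoulli's inequality for `x / y`. -/
lemma add_mul_sub_le_rpow {α x y b : ℝ} (hα : α ∈ Ioo (0 : ℝ) 1) (hx : 0 ≤ x) (hxy : x ≤ y)
    (hyb : y ≤ b) : x ^ α + α * b ^ (α - 1) * (y - x) ≤ y ^ α := by
  rcases (hx.trans hxy).eq_or_lt with rfl | hy
  · obtain rfl : x = 0 := le_antisymm hxy hx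
    simp
  have h1 := rpow_one_add_le_one_add_mul_self (s := x / y - 1) (p := α)
    (by linarith [div_nonneg hx hy.le]) hα.1.le hα.2.le
  rw [add_sub_cancel, Real.div_rpow hx hy.le, div_le_iff₀ (by positivity)] at h1
  have h2 : (1 + α * (x / y - 1)) * y ^ α = y ^ α - α * y ^ (α - 1) * (y - x) := by
    rw [Real.rpow_sub_one hy.ne']
    field_simp
    ring
  have h3 : b ^ (α - 1) ≤ y ^ (α - 1) :=
    Real.rpow_le_rpow_of_nonpos hy hyb (by linarith [hα.2])
  have h4 := mul_le_mul_of_nonneg_right (mul_le_mul_of_nonneg_left h3 hα.1.le)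
    (sub_nonneg.2 hxy)
  linarith

lemma rpow_add_mul_le_add_rpow {α b : ℝ} {x d : ℝ≥0∞} (hα : α ∈ Ioo (0 : ℝ) 1) (hb : 0 ≤ b)
    (h : x + d ≤ ENNReal.ofReal b) :
    x ^ α + ENNReal.ofReal (α * b ^ (α - 1)) * d ≤ (x + d) ^ α := by
  have hx : x ≠ ∞ := ne_top_of_le_ne_top ENNReal.ofReal_ne_top (le_self_add.trans h)
  have hd : d ≠ ∞ := ne_top_of_le_ne_top ENNReal.ofReal_ne_top (le_add_self.trans h)
  obtain ⟨x', hx'0, rfl⟩ : ∃ r : ℝ, 0 ≤ r ∧ x = ENNReal.ofReal r :=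
    ⟨_, ENNReal.toReal_nonneg, (ENNReal.ofReal_toReal hx).symm⟩
  obtain ⟨d', hd'0, rfl⟩ : ∃ r : ℝ, 0 ≤ r ∧ d = ENNReal.ofReal r :=
    ⟨_, ENNReal.toReal_nonneg, (ENNReal.ofReal_toReal hd).symm⟩
  have hα0 := hα.1
  rw [← ENNReal.ofReal_add hx'0 hd'0, ENNReal.ofReal_le_ofReal_iff hb] at h
  rw [← ENNReal.ofReal_add hx'0 hd'0, ENNReal.ofReal_rpow_of_nonneg hx'0 hα.1.le,
    ENNReal.ofReal_rpow_of_nonneg (by positivity) hα.1.le, ← ENNReal.ofReal_mul (by positivity),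
    ← ENNReal.ofReal_add (by positivity) (by positivity)]
  refine ENNReal.ofReal_le_ofReal ?_
  simpa using add_mul_sub_le_rpow hα hx'0 (le_add_of_nonneg_right hd'0) h

/-- Tonelli on `{t < s}`: savings along the stem at `t` become a marginal cost of each leaf at `s`.
-/
lemma lintegral_mul_lintegral_Ioi {w d : ℝ → ℝ≥0∞} (hw : Measurable w)
    (hd : AEMeasurable d (volume.restrict (Ioi 0))) :
    ∫⁻ t in Ioi 0, w t * ∫⁻ s in Ioi t, d s = ∫⁻ s in Ioi 0, d s * ∫⁻ t in Ioo 0 s, w t := by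
  have h1 : ∀ t, 0 < t → w t * ∫⁻ s in Ioi t, d s
      = ∫⁻ s in Ioi 0, (Ioi t).indicator (fun s => w t * d s) s := by
    intro t ht
    rw [lintegral_indicator measurableSet_Ioi, Measure.restrict_restrict measurableSet_Ioi,
      inter_eq_left.2 (Ioi_subset_Ioi ht.le), lintegral_const_mul'']
    exact hd.mono_measure (Measure.restrict_mono (Ioi_subset_Ioi ht.le) le_rfl)
  have h2 : ∀ s, d s * ∫⁻ t in Ioo 0 s, w t
      = ∫⁻ t in Ioi 0, (Ioi t).indicator (fun s => w t * d s) s := by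
    intro s
    have : ∀ t, (Ioi t).indicator (fun s => w t * d s) s
        = (Iio s).indicator (fun t => d s * w t) t := by
      intro t
      by_cases hts : t < s <;> simp [hts, mul_comm]
    simp only [this]
    rw [lintegral_indicator measurableSet_Iio, Measure.restrict_restrict measurableSet_Iio,
      inter_comm, Ioi_inter_Iio, lintegral_const_mul _ hw]
  rw [setLIntegral_congr_fun measurableSet_Ioi fun t ht => h1 t ht]
  simp only [h2]
  refine lintegral_lintegral_swap ?_
  have h3 : Function.uncurry (fun t s => (Ioi t).indicator (fun s => w t * d s) s)
      = {p : ℝ × ℝ | p.1 < p.2}.indicator (fun p => w p.1 * d p.2) := by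
    ext ⟨t, s⟩
    by_cases hts : t < s <;> simp [hts]
  rw [h3]
  exact ((hw.comp measurable_fst).aemeasurable.mul hd.comp_snd).indicator
    (measurableSet_lt measurable_fst measurable_snd)

/-- The coefficient of the lower bound `capCoeff α c * s ^ α⁻¹` for the marginal irrigation cost
of leaves at distance `s` from the root. -/
def capCoeff (α c : ℝ) : ℝ := c * (α * (costBound α c ^ (1 - α⁻¹) * α))

/-- An upper bound for the leaf density: more leaves than this do not pay off. -/
def cap (α c s : ℝ) : ℝ := max 0 (-Real.log (capCoeff α c * s ^ α⁻¹))

lemma capCoeff_pos {α c : ℝ} (hα : 0 < α) (hc : 0 < c) : 0 < capCoeff α c := by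
  have := Real.rpow_pos_of_pos (costBound_pos (α := α) hc) (1 - α⁻¹)
  unfold capCoeff
  positivity

lemma cap_nonneg (α c s : ℝ) : 0 ≤ cap α c s := le_max_left _ _

lemma measurable_cap (α c : ℝ) : Measurable (cap α c) := by
  unfold cap
  fun_prop

lemma exp_neg_cap_le {α c s : ℝ} (hα : 0 < α) (hc : 0 < c) (hs : 0 < s) :
    Real.exp (-cap α c s) ≤ capCoeff α c * s ^ α⁻¹ := by
  have h : 0 < capCoeff α c * s ^ α⁻¹ := mul_pos (capCoeff_pos hα hc) (Real.rpow_pos_of_pos hs _)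
  calc Real.exp (-cap α c s) ≤ Real.exp (Real.log (capCoeff α c * s ^ α⁻¹)) :=
        Real.exp_le_exp.2 (neg_le.1 (le_max_right _ _))
    _ = _ := Real.exp_log h

/-- No leaves pay off at a distance larger than this. -/
def capSupport (α c : ℝ) : ℝ := (capCoeff α c)⁻¹ ^ α

lemma capSupport_pos {α c : ℝ} (hα : 0 < α) (hc : 0 < c) : 0 < capSupport α c :=
  Real.rpow_pos_of_pos (inv_pos.2 (capCoeff_pos hα hc)) _

lemma cap_eq_zero {α c s : ℝ} (hα : 0 < α) (hc : 0 < c) (hs : capSupport α c ≤ s) :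
    cap α c s = 0 := by
  have hK := capCoeff_pos hα hc
  refine max_eq_left (neg_nonpos.2 (Real.log_nonneg ?_))
  have h1 := Real.rpow_le_rpow (capSupport_pos hα hc).le hs (inv_nonneg.2 hα.le)
  rw [capSupport, Real.rpow_rpow_inv (inv_nonneg.2 hK.le) hα.ne'] at h1
  have h2 := mul_le_mul_of_nonneg_left h1 hK.le
  rwa [mul_inv_cancel₀ hK.ne'] at h2

lemma memLp_rpow_neg_quarter (S : ℝ) :
    MemLp (fun s : ℝ => s ^ (-(1 / 4) : ℝ)) 2 (volume.restrict (Ioc 0 S)) := by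
  rw [memLp_two_iff_integrable_sq (by fun_prop)]
  rcases le_total S 0 with hS | hS
  · simp [Ioc_eq_empty (not_lt.2 hS)]
  have h := intervalIntegral.intervalIntegrable_rpow' (a := 0) (b := S) (r := -(1 / 2))
    (by norm_num)
  rw [intervalIntegrable_iff_integrableOn_Ioc_of_le hS] at h
  refine h.congr_fun (fun s hs => ?_) measurableSet_Ioc
  rw [← Real.rpow_natCast, ← Real.rpow_mul hs.1.le]
  norm_num

/-- The exponent only has to exceed `-1/2`, so that the majorant is square integrable at the root.
-/
lemma abs_log_le {s : ℝ} (hs : 0 < s) : |Real.log s| ≤ s + 4 * s ^ (-(1 / 4) : ℝ) := by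
  have h1 := Real.log_le_sub_one_of_pos hs
  have h2 := Real.log_le_rpow_div (inv_nonneg.2 hs.le) (show (0 : ℝ) < 1 / 4 by norm_num)
  rw [Real.log_inv, Real.inv_rpow hs.le, ← Real.rpow_neg hs.le] at h2
  have h3 := Real.rpow_nonneg hs.le (-(1 / 4) : ℝ)
  rw [abs_le]
  constructor <;> linarith

lemma memLp_cap {α c : ℝ} (hα : 0 < α) (hc : 0 < c) (S : ℝ) :
    MemLp (cap α c) 2 (volume.restrict (Ioc 0 S)) := by
  have hA : MemLp (fun _ : ℝ => |Real.log (capCoeff α c)| + α⁻¹ * S) 2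
      (volume.restrict (Ioc 0 S)) := memLp_const _
  refine (hA.add ((memLp_rpow_neg_quarter S).const_mul (α⁻¹ * 4))).mono'
    (measurable_cap α c).aestronglyMeasurable ?_
  filter_upwards [ae_restrict_mem measurableSet_Ioc] with s hs
  have h1 := abs_log_le hs.1
  have h2 : Real.log (capCoeff α c * s ^ α⁻¹) = Real.log (capCoeff α c) + α⁻¹ * Real.log s := by
    rw [Real.log_mul (capCoeff_pos hα hc).ne' (Real.rpow_pos_of_pos hs.1 _).ne',
      Real.log_rpow hs.1]
  have h3 : α⁻¹ * |Real.log s| ≤ α⁻¹ * (S + 4 * s ^ (-(1 / 4) : ℝ)) :=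
    mul_le_mul_of_nonneg_left (by linarith [hs.2]) (inv_nonneg.2 hα.le)
  have h4 : α⁻¹ * |Real.log s| = |α⁻¹ * Real.log s| := by
    rw [abs_mul, abs_of_nonneg (inv_nonneg.2 hα.le)]
  rw [Real.norm_eq_abs, abs_of_nonneg (cap_nonneg _ _ _), cap, h2, Pi.add_apply]
  refine max_le ?_ ?_
  · have := abs_nonneg (Real.log (capCoeff α c))
    have := (mul_nonneg (inv_nonneg.2 hα.le) (abs_nonneg (Real.log s))).trans h3
    linarith
  · have := neg_le_abs (Real.log (capCoeff α c))
    have := neg_le_abs (α⁻¹ * Real.log s)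
    linarith

lemma integrableOn_cap {α c : ℝ} (hα : 0 < α) (hc : 0 < c) : IntegrableOn (cap α c) (Ioi 0) := by
  rw [← Ioc_union_Ioi_eq_Ioi (capSupport_pos hα hc).le]
  refine IntegrableOn.union ((memLp_cap hα hc _).integrable (by norm_num)) ?_
  exact integrableOn_zero.congr_fun (fun s hs => (cap_eq_zero hα hc (le_of_lt hs)).symm)
    measurableSet_Ioi

lemma lintegral_rpow_Ioo {r a s : ℝ} (hr : 0 < r) (ha : 0 ≤ a) (hs : 0 ≤ s) :
    ∫⁻ t in Ioo 0 s, ENNReal.ofReal (a * t ^ (r⁻¹ - 1)) = ENNReal.ofReal (a * (s ^ r⁻¹ * r)) := by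
  have hr' : (-1 : ℝ) < r⁻¹ - 1 := by linarith [inv_pos.2 hr]
  rw [setLIntegral_congr Ioo_ae_eq_Ioc, ← ofReal_integral_eq_lintegral_ofReal]
  · congr 1
    rw [integral_const_mul, ← intervalIntegral.integral_of_le hs, integral_rpow (Or.inl hr'),
      sub_add_cancel, Real.zero_rpow (inv_pos.2 hr).ne', sub_zero, div_inv_eq_mul]
  · exact (intervalIntegrable_iff_integrableOn_Ioc_of_le hs).1
      ((intervalIntegral.intervalIntegrable_rpow' hr').const_mul a)
  · filter_upwards [ae_restrict_mem measurableSet_Ioc] with t ht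
    exact mul_nonneg ha (Real.rpow_nonneg ht.1.le _)

lemma IsDensityControl.of_le {u v : ℝ → ℝ} (hu : IsDensityControl u)
    (hv : AEMeasurable v (volume.restrict (Ioi 0))) (hv0 : ∀ t, 0 ≤ t → 0 ≤ v t)
    (hvu : ∀ t, v t ≤ u t) : IsDensityControl v where
  aemeasurable := hv
  nonneg := hv0
  tendsto_massBeyond := tendsto_of_tendsto_of_tendsto_of_le_of_le tendsto_const_nhds
    hu.tendsto_massBeyond (fun _ => zero_le) fun _ =>
      lintegral_mono fun s => ENNReal.ofReal_le_ofReal (hvu s)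

lemma IsDensityControl.truncate {u : ℝ → ℝ} (hu : IsDensityControl u) (α c : ℝ) :
    IsDensityControl fun t => min (u t) (cap α c t) :=
  hu.of_le (hu.aemeasurable.min (measurable_cap α c).aemeasurable)
    (fun t ht => le_min (hu.nonneg t ht) (cap_nonneg _ _ _)) fun _ => min_le_left _ _

/-- Removing the leaves in excess of `cap α c` saves more than a linear cost. -/
lemma irrigationCost_truncate {α c : ℝ} {u : ℝ → ℝ} (hα : α ∈ Ioo (0 : ℝ) 1) (hc : 0 < c)
    (hu : IsDensityControl u)
    (hcost : irrigationCost α (massBeyond u) ≤ ENNReal.ofReal (costBound α c)) :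
    ENNReal.ofReal c * irrigationCost α (massBeyond fun t => min (u t) (cap α c t))
      + ∫⁻ s in Ioi 0, ENNReal.ofReal (capCoeff α c * s ^ α⁻¹ * (u s - min (u s) (cap α c s)))
      ≤ ENNReal.ofReal c * irrigationCost α (massBeyond u) := by
  set v : ℝ → ℝ := fun t => min (u t) (cap α c t) with hv
  have hvc := hu.truncate α c
  have hC := costBound_pos (α := α) hc
  have hα0 := hα.1
  set a : ℝ := α * costBound α c ^ (1 - α⁻¹) with ha
  have ha0 : 0 ≤ a := mul_nonneg hα.1.le (Real.rpow_nonneg hC.le _)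
  have hd : AEMeasurable (fun s => ENNReal.ofReal (u s - v s)) (volume.restrict (Ioi 0)) :=
    (hu.aemeasurable.sub hvc.aemeasurable).ennreal_ofReal
  have hsplit : ∀ t, 0 < t →
      massBeyond u t = massBeyond v t + ∫⁻ s in Ioi t, ENNReal.ofReal (u s - v s) := by
    intro t ht
    unfold massBeyond
    rw [← lintegral_add_right' _ (hd.mono_measure
      (Measure.restrict_mono (Ioi_subset_Ioi ht.le) le_rfl))]
    refine setLIntegral_congr_fun measurableSet_Ioi fun s hs => ?_
    have hs0 : 0 ≤ s := ht.le.trans (le_of_lt hs)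
    change _ = ENNReal.ofReal _ + ENNReal.ofReal _
    rw [← ENNReal.ofReal_add (hvc.nonneg s hs0) (sub_nonneg.2 (min_le_left _ _)), add_sub_cancel]
  have hw : Measurable fun t : ℝ => ENNReal.ofReal (a * t ^ (α⁻¹ - 1)) := by fun_prop
  -- At each `t` the tail is at most `(C / t) ^ α⁻¹`, where `C = costBound α c`. By concavity, each
  -- unit of mass removed beyond `t` then saves at least `a * t ^ (α⁻¹ - 1)`.
  have key : irrigationCost α (massBeyond v) + ∫⁻ s in Ioi 0,
      ENNReal.ofReal (u s - v s) * ∫⁻ t in Ioo 0 s, ENNReal.ofReal (a * t ^ (α⁻¹ - 1))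
      ≤ irrigationCost α (massBeyond u) := by
    rw [← lintegral_mul_lintegral_Ioi hw hd]
    unfold irrigationCost
    rw [← lintegral_add_left ((antitone_massBeyond v).measurable.pow_const α)]
    refine setLIntegral_mono' measurableSet_Ioi fun t ht => ?_
    have ht0 : 0 < t := ht
    have h1 := tail_le_of_irrigationCost_le hα.1 (antitone_massBeyond u) ht0 hcost
    rw [ENNReal.ofReal_rpow_of_pos (by positivity), hsplit t ht0] at h1
    have h2 := rpow_add_mul_le_add_rpow hα (by positivity) h1
    rw [hsplit t ht0]
    have h3 : α * ((costBound α c / t) ^ α⁻¹) ^ (α - 1) = a * t ^ (α⁻¹ - 1) := by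
      have h4 : α⁻¹ * (α - 1) = 1 - α⁻¹ := by field_simp
      rw [← Real.rpow_mul (by positivity), h4, Real.div_rpow hC.le ht0.le, ha,
        div_eq_mul_inv, ← Real.rpow_neg ht0.le, neg_sub, mul_assoc]
    rw [h3] at h2
    exact h2
  refine le_trans (le_of_eq ?_) (mul_le_mul_right key (ENNReal.ofReal c))
  rw [mul_add, ← lintegral_const_mul' _ _ ENNReal.ofReal_ne_top]
  congr 1
  refine setLIntegral_congr_fun measurableSet_Ioi fun s hs => ?_
  have hs0 : 0 < s := hs
  have h5 : 0 ≤ u s - v s := sub_nonneg.2 (min_le_left _ _)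
  change _ = ENNReal.ofReal c * (ENNReal.ofReal (u s - v s) * _)
  rw [lintegral_rpow_Ioo hα.1 ha0 hs0.le, ← ENNReal.ofReal_mul h5, ← ENNReal.ofReal_mul hc.le]
  congr 1
  simp only [capCoeff, ha, hv]
  ring

lemma sunlight_truncate {I : ℝ → ℝ} {α c θ₀ : ℝ} {θ u : ℝ → ℝ} (hα : α ∈ Ioo (0 : ℝ) 1)
    (hc : 0 < c) (hθ₀ : θ₀ ∈ Ioo 0 (Real.pi / 2)) (hI_mem : ∀ y, 0 ≤ y → I y ∈ Icc (0 : ℝ) 1)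
    (hθ : IsAngleControl θ₀ θ) (hu : IsDensityControl u) :
    sunlight I θ₀ θ u ≤ sunlight I θ₀ θ (fun t => min (u t) (cap α c t))
      + ∫⁻ s in Ioi 0, ENNReal.ofReal (capCoeff α c * s ^ α⁻¹ * (u s - min (u s) (cap α c s))) := by
  have hvc := hu.truncate α c
  unfold sunlight
  have hm : AEMeasurable (fun s => ENNReal.ofReal (capCoeff α c * s ^ α⁻¹
      * (u s - min (u s) (cap α c s)))) (volume.restrict (Ioi 0)) :=
    AEMeasurable.ennreal_ofReal (AEMeasurable.mul (by fun_prop)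
      (hu.aemeasurable.sub hvc.aemeasurable))
  rw [← lintegral_add_right' _ hm]
  refine setLIntegral_mono' measurableSet_Ioi fun s hs => ?_
  have hs0 : 0 < s := hs
  have hv0 := hvc.nonneg s hs0.le
  have hx := hθ.mem_Icc s hs0.le
  have hI := hI_mem _ (hθ.height_nonneg hθ₀ hs0.le)
  have hd : 0 ≤ u s - min (u s) (cap α c s) := sub_nonneg.2 (min_le_left _ _)
  have hm : 0 ≤ capCoeff α c * s ^ α⁻¹ :=
    mul_nonneg (capCoeff_pos hα.1 hc).le (Real.rpow_nonneg hs0.le _)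
  rw [← ENNReal.ofReal_add (mul_nonneg hI.1 (gain_nonneg hθ₀ hx hv0)) (mul_nonneg hm hd)]
  refine ENNReal.ofReal_le_ofReal ?_
  have h1 := gain_le_add hθ₀ hx hv0 (min_le_left (u s) (cap α c s))
  -- Either nothing is removed at `s`, or the remaining density equals the cap.
  have h2 : Real.exp (-min (u s) (cap α c s)) * (u s - min (u s) (cap α c s))
      ≤ capCoeff α c * s ^ α⁻¹ * (u s - min (u s) (cap α c s)) := by
    rcases le_total (u s) (cap α c s) with h | h
    · simp [min_eq_left h]
    · refine mul_le_mul_of_nonneg_right ?_ hd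
      rw [min_eq_right h]
      exact exp_neg_cap_le hα.1 hc hs0
  have h3 := mul_le_mul_of_nonneg_left (h1.trans (add_le_add_right h2 _)) hI.1
  rw [mul_add] at h3
  exact h3.trans (add_le_add_right (mul_le_of_le_one_left (mul_nonneg hm hd) hI.2) _)

/-- Truncating the leaf density at `cap α c` does not decrease the payoff. -/
lemma payoff_le_payoff_truncate {I : ℝ → ℝ} {α c θ₀ : ℝ} {θ u : ℝ → ℝ} (hα : α ∈ Ioo (0 : ℝ) 1)
    (hc : 0 < c) (hθ₀ : θ₀ ∈ Ioo 0 (Real.pi / 2)) (hI_mem : ∀ y, 0 ≤ y → I y ∈ Icc (0 : ℝ) 1)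
    (hθ : IsAngleControl θ₀ θ) (hu : IsDensityControl u)
    (h : 0 ≤ payoff I α c θ₀ θ u (massBeyond u)) :
    payoff I α c θ₀ θ u (massBeyond u) ≤ payoff I α c θ₀ θ (fun t => min (u t) (cap α c t))
      (massBeyond fun t => min (u t) (cap α c t)) := by
  have h1 := irrigationCost_truncate hα hc hu
    (irrigationCost_le_costBound hα.1 hc hθ₀ hI_mem hθ hu.nonneg h)
  have h2 := sunlight_truncate hα hc hθ₀ hI_mem hθ hu
  have h3 := (le_of_coe_sub_coe_nonneg h).2
  -- The same integral bounds the light lost from above and the cost saved from below.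
  refine coe_sub_coe_le h3 (ne_top_of_le_ne_top h3 (le_self_add.trans h1)) ?_
  calc _ ≤ _ := add_le_add_left h2 _
    _ = _ := by rw [add_assoc, add_comm (∫⁻ s in Ioi 0, _)]
    _ ≤ _ := add_le_add_right h1 _

section

/-! ### Limits of controls -/

variable {θ₀ : ℝ}

/-- Controls whose leaf density is dominated by `k`. -/
structure IsBoundedControl (θ₀ : ℝ) (k θ u : ℝ → ℝ) : Prop where
  angle : IsAngleControl θ₀ θ
  aemeasurable : AEMeasurable u (volume.restrict (Ioi 0))
  nonneg : ∀ t, 0 ≤ t → 0 ≤ u t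
  le : ∀ t, 0 ≤ t → u t ≤ k t

namespace IsBoundedControl

variable {k θ u : ℝ → ℝ} {S : ℝ}

lemma memLp_density (h : IsBoundedControl θ₀ k θ u) (hk : MemLp k 2 (volume.restrict (Ioc 0 S))) :
    MemLp u 2 (volume.restrict (Ioc 0 S)) := by
  refine hk.mono' (h.aemeasurable.mono_measure
    (Measure.restrict_mono Ioc_subset_Ioi_self le_rfl)).aestronglyMeasurable ?_
  filter_upwards [ae_restrict_mem measurableSet_Ioc] with t ht
  rw [Real.norm_eq_abs, abs_of_nonneg (h.nonneg t ht.1.le)]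
  exact h.le t ht.1.le

lemma integrableOn_density (h : IsBoundedControl θ₀ k θ u) (hk : IntegrableOn k (Ioi 0)) :
    IntegrableOn u (Ioi 0) := by
  refine Integrable.mono' hk h.aemeasurable.aestronglyMeasurable ?_
  filter_upwards [ae_restrict_mem measurableSet_Ioi] with t ht
  have ht0 : 0 ≤ t := le_of_lt ht
  rw [Real.norm_eq_abs, abs_of_nonneg (h.nonneg t ht0)]
  exact h.le t ht0

lemma density_eq_zero (h : IsBoundedControl θ₀ k θ u) (hS : 0 ≤ S) (hkS : ∀ t, S ≤ t → k t = 0)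
    {t : ℝ} (ht : S ≤ t) : u t = 0 :=
  le_antisymm ((h.le t (hS.trans ht)).trans_eq (hkS t ht)) (h.nonneg t (hS.trans ht))

/-- The tail is a pairing with an `L²` indicator, so weak convergence of densities gives pointwise
convergence of tails. -/
lemma massBeyond_eq (h : IsBoundedControl θ₀ k θ u) (hS : 0 ≤ S) (hkS : ∀ t, S ≤ t → k t = 0)
    (hk : MemLp k 2 (volume.restrict (Ioc 0 S))) {t : ℝ} (ht : 0 ≤ t) :
    massBeyond u t = ENNReal.ofReal
      (∫ s in Ioc 0 S, (Ioi t).indicator (fun _ => (1 : ℝ)) s * u s) := by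
  have hu := h.memLp_density hk
  have h1 : ∀ s, (Ioi t).indicator (fun _ => (1 : ℝ)) s * u s = (Ioi t).indicator u s := by
    intro s
    by_cases hs : s ∈ Ioi t <;> simp [hs]
  simp only [h1]
  rw [ofReal_integral_eq_lintegral_ofReal
    ((hu.integrable (by norm_num)).indicator measurableSet_Ioi)]
  · have h2 : ∀ s, ENNReal.ofReal ((Ioi t).indicator u s)
        = (Ioi t).indicator (fun s => ENNReal.ofReal (u s)) s := by
      intro s
      by_cases hs : s ∈ Ioi t <;> simp [hs]
    simp only [h2]
    rw [lintegral_indicator measurableSet_Ioi, Measure.restrict_restrict measurableSet_Ioi,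
      massBeyond]
    have h3 : (Ioi t ∩ Ioc 0 S) ∪ (Ioi t ∩ Ioi S) = Ioi t := by
      rw [← inter_union_distrib_left, Ioc_union_Ioi_eq_Ioi hS]
      exact inter_eq_left.2 (Ioi_subset_Ioi ht)
    conv_lhs => rw [← h3]
    refine le_antisymm ((lintegral_union_le _ _ _).trans_eq ?_)
      (lintegral_mono_set subset_union_left)
    have h4 : ∫⁻ s in Ioi t ∩ Ioi S, ENNReal.ofReal (u s) = 0 := by
      refine setLIntegral_eq_zero (measurableSet_Ioi.inter measurableSet_Ioi) fun s hs => ?_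
      simp [h.density_eq_zero hS hkS (le_of_lt hs.2)]
    rw [h4, add_zero]
  · filter_upwards [ae_restrict_mem measurableSet_Ioc] with s hs
    exact indicator_apply_nonneg fun _ => h.nonneg s hs.1.le

end IsBoundedControl

end

section

variable {θ₀ : ℝ} {k : ℝ → ℝ} {S : ℝ}

lemma IsAngleControl.memLp_comp {θ : ℝ → ℝ} (h : IsAngleControl θ₀ θ) {f : ℝ → ℝ}
    (hf : Measurable f) (hf1 : ∀ x, |f x| ≤ 1) :
    MemLp (fun t => f (θ t)) 2 (volume.restrict (Ioc 0 S)) :=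
  MemLp.of_bound (hf.comp_aemeasurable
    (h.aemeasurable_restrict Ioc_subset_Ioi_self)).aestronglyMeasurable 1
    (Eventually.of_forall fun t => hf1 (θ t))

/-- Weak limits of `sin θₙ` and `cos θₙ` lie in the unit disc. -/
lemma sq_add_sq_le_one_of_weakTendsto {μ : Measure ℝ} [IsFiniteMeasure μ] {θ : ℕ → ℝ → ℝ}
    {v w : ℝ → ℝ} (hθ : ∀ n, AEMeasurable (θ n) μ) (hvm : Measurable v) (hwm : Measurable w)
    (hv1 : ∀ᵐ t ∂μ, |v t| ≤ 1) (hw1 : ∀ᵐ t ∂μ, |w t| ≤ 1)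
    (hv : WeakTendsto μ (fun n t => Real.cos (θ n t)) v)
    (hw : WeakTendsto μ (fun n t => Real.sin (θ n t)) w) :
    ∀ᵐ t ∂μ, w t ^ 2 + v t ^ 2 ≤ 1 := by
  have hc : ∀ n, MemLp (fun t => Real.cos (θ n t)) 2 μ := fun n =>
    MemLp.of_bound (Real.measurable_cos.comp_aemeasurable (hθ n)).aestronglyMeasurable 1
      (Eventually.of_forall fun t => Real.abs_cos_le_one _)
  have hs : ∀ n, MemLp (fun t => Real.sin (θ n t)) 2 μ := fun n =>
    MemLp.of_bound (Real.measurable_sin.comp_aemeasurable (hθ n)).aestronglyMeasurable 1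
      (Eventually.of_forall fun t => Real.abs_sin_le_one _)
  have hvL : MemLp v ∞ μ := memLp_top_of_bound hvm.aestronglyMeasurable 1 hv1
  have hwL : MemLp w ∞ μ := memLp_top_of_bound hwm.aestronglyMeasurable 1 hw1
  have hv2 : MemLp v 2 μ := hvL.mono_exponent le_top
  have hw2 : MemLp w 2 μ := hwL.mono_exponent le_top
  -- Pairing `(sin θₙ, cos θₙ)` with the limit `(w, v)` itself: by Cauchy–Schwarz the products stay
  -- below `√(w² + v²)`, while their weak limit is `w² + v²`.
  have h1 := (hw.bdd_mul hwm.aestronglyMeasurable hw1).add (hv.bdd_mul hvm.aestronglyMeasurable hv1)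
    (fun n => (hs n).mul hwL) (fun n => (hc n).mul hvL) (hw2.mul hwL) (hv2.mul hvL)
  have h2 : Integrable (fun t => √(w t ^ 2 + v t ^ 2)) μ := by
    refine Integrable.of_bound (C := √2) (by fun_prop) ?_
    filter_upwards [hv1, hw1] with t h3 h4
    rw [Real.norm_eq_abs, abs_of_nonneg (Real.sqrt_nonneg _)]
    refine Real.sqrt_le_sqrt ?_
    have := (sq_le_one_iff_abs_le_one _).2 h3
    have := (sq_le_one_iff_abs_le_one _).2 h4
    linarith
  have h3 := h1.ae_le (fun n => ((hs n).mul hwL).add ((hc n).mul hvL))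
    ((hw2.mul hwL).add (hv2.mul hvL)) h2 fun n => Eventually.of_forall fun t => by
      refine Real.le_sqrt_of_sq_le ?_
      have h5 := Real.sin_sq_add_cos_sq (θ n t)
      nlinarith [sq_nonneg (w t * Real.cos (θ n t) - v t * Real.sin (θ n t))]
  filter_upwards [h3] with t ht
  have h4 : w t ^ 2 + v t ^ 2 ≤ √(w t ^ 2 + v t ^ 2) := by linarith
  have h5 := Real.sq_sqrt (show 0 ≤ w t ^ 2 + v t ^ 2 by positivity)
  have h6 := Real.sqrt_nonneg (w t ^ 2 + v t ^ 2)
  by_contra! h7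
  have h8 : 1 < √(w t ^ 2 + v t ^ 2) := by
    rw [Real.lt_sqrt zero_le_one]; simpa using h7
  nlinarith

/-- The circle is not convex, so the weak limit `(v, w)` of `(cos θₙ, sin θₙ)` need not come from an
angle. Rebuilding the angle from `w` alone gives `cos θ' = √(1 - w²) ≥ v`. Since `cos θ₀ ≥ 0`, this
leaves only the inequality for `q`, in the favourable direction. -/
lemma exists_limit_control (hθ₀ : θ₀ ∈ Ioo 0 (Real.pi / 2)) (hk0 : ∀ t, 0 ≤ k t)
    (hkm : Measurable k) (hk : MemLp k 2 (volume.restrict (Ioc 0 S))) {θ u : ℕ → ℝ → ℝ}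
    (hθu : ∀ n, IsBoundedControl θ₀ k (θ n) (u n)) :
    ∃ φ : ℕ → ℕ, StrictMono φ ∧ ∃ θ' u' q : ℝ → ℝ, IsBoundedControl θ₀ k θ' u' ∧
      MemLp q 2 (volume.restrict (Ioc 0 S)) ∧
      (∀ᵐ t ∂volume.restrict (Ioc 0 S), q t ≤ Real.cos (θ' t - θ₀)) ∧
      WeakTendsto (volume.restrict (Ioc 0 S)) (fun n t => Real.sin (θ (φ n) t))
        (fun t => Real.sin (θ' t)) ∧
      WeakTendsto (volume.restrict (Ioc 0 S)) (fun n t => Real.cos (θ (φ n) t - θ₀)) q ∧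
      WeakTendsto (volume.restrict (Ioc 0 S)) (fun n => u (φ n)) u' := by
  set μ := volume.restrict (Ioc 0 S) with hμ
  have hs : ∀ n, MemLp (fun t => Real.sin (θ n t)) 2 μ := fun n =>
    (hθu n).angle.memLp_comp Real.measurable_sin Real.abs_sin_le_one
  have hc : ∀ n, MemLp (fun t => Real.cos (θ n t)) 2 μ := fun n =>
    (hθu n).angle.memLp_comp Real.measurable_cos Real.abs_cos_le_one
  have hu : ∀ n, MemLp (u n) 2 μ := fun n => (hθu n).memLp_density hk
  have hpos : ∀ᵐ t ∂μ, 0 < t := (ae_restrict_mem measurableSet_Ioc).mono fun t ht => ht.1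
  obtain ⟨φ₁, hφ₁, w, hwm, hwL, hw⟩ := exists_weakTendsto_subseq (memLp_const (1 : ℝ))
    (fun n => (hs n).aestronglyMeasurable) fun n => Eventually.of_forall fun t =>
      Real.abs_sin_le_one (θ n t)
  obtain ⟨φ₂, hφ₂, v, hvm, hvL, hv⟩ := exists_weakTendsto_subseq (memLp_const (1 : ℝ))
    (fun n => (hc (φ₁ n)).aestronglyMeasurable) fun n => Eventually.of_forall fun t =>
      Real.abs_cos_le_one (θ (φ₁ n) t)
  obtain ⟨φ₃, hφ₃, g, hgm, hgL, hg⟩ := exists_weakTendsto_subseq hk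
    (fun n => (hu (φ₁ (φ₂ n))).aestronglyMeasurable) fun n => by
      filter_upwards [hpos] with t ht
      rw [abs_of_nonneg ((hθu _).nonneg t ht.le)]
      exact (hθu _).le t ht.le
  set φ : ℕ → ℕ := fun n => φ₁ (φ₂ (φ₃ n)) with hφ
  have hw' : WeakTendsto μ (fun n t => Real.sin (θ (φ n) t)) w := (hw.comp hφ₂).comp hφ₃
  have hv' : WeakTendsto μ (fun n t => Real.cos (θ (φ n) t)) v := hv.comp hφ₃
  have hw_le : ∀ᵐ t ∂μ, w t ≤ 1 := hw'.ae_le (fun n => hs _) hwL (integrable_const _)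
    fun n => Eventually.of_forall fun t => Real.sin_le_one _
  have hw_ge : ∀ᵐ t ∂μ, Real.sin θ₀ ≤ w t := hw'.ae_ge (fun n => hs _) hwL (integrable_const _)
    fun n => hpos.mono fun t ht => ((hθu _).angle.sin_mem hθ₀ ht.le).1
  have hv_le : ∀ᵐ t ∂μ, v t ≤ 1 := hv'.ae_le (fun n => hc _) hvL (integrable_const _)
    fun n => Eventually.of_forall fun t => Real.cos_le_one _
  have hv_ge : ∀ᵐ t ∂μ, 0 ≤ v t := hv'.ae_ge (fun n => hc _) hvL (integrable_const _)
    fun n => hpos.mono fun t ht => Real.cos_nonneg_of_mem_Icc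
      ⟨by linarith [((hθu (φ n)).angle.mem_Icc t ht.le).1, hθ₀.1, Real.pi_pos],
        ((hθu (φ n)).angle.mem_Icc t ht.le).2⟩
  have hg_ge : ∀ᵐ t ∂μ, 0 ≤ g t := hg.ae_ge (fun n => hu _) hgL (integrable_const _)
    fun n => hpos.mono fun t ht => (hθu _).nonneg t ht.le
  have hg_le : ∀ᵐ t ∂μ, g t ≤ k t := hg.ae_le (fun n => hu _) hgL (hk.integrable (by norm_num))
    fun n => hpos.mono fun t ht => (hθu _).le t ht.le
  have hsin0 := IsAngleControl.sin_pos hθ₀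
  have hdisc : ∀ᵐ t ∂μ, w t ^ 2 + v t ^ 2 ≤ 1 := by
    refine sq_add_sq_le_one_of_weakTendsto (θ := fun n => θ (φ n))
      (fun n => (hθu _).angle.aemeasurable_restrict Ioc_subset_Ioi_self) hvm hwm ?_ ?_ hv' hw'
    · filter_upwards [hv_le, hv_ge] with t h1 h2
      rwa [abs_of_nonneg h2]
    · filter_upwards [hw_le, hw_ge] with t h1 h2
      rwa [abs_of_nonneg (hsin0.le.trans h2)]
  -- Weak limits obey their bounds only a.e. on `(0, S]`; the clamp enforces them everywhere and
  -- changes nothing a.e. there. The density is clamped below for the same reason.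
  set θ' : ℝ → ℝ := fun t => Real.arcsin (max (Real.sin θ₀) (min (w t) 1)) with hθ'
  have hclamp : ∀ᵐ t ∂μ, θ' t = Real.arcsin (w t) := by
    filter_upwards [hw_le, hw_ge] with t h1 h2
    simp only [hθ']
    rw [min_eq_left h1, max_eq_right h2]
  have hsin : ∀ᵐ t ∂μ, w t = Real.sin (θ' t) := by
    filter_upwards [hclamp, hw_le, hw_ge] with t h1 h2 h3
    rw [h1, Real.sin_arcsin (by linarith) h2]
  refine ⟨φ, (hφ₁.comp hφ₂).comp hφ₃, θ', fun t => max 0 (min (g t) (k t)),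
    fun t => Real.cos θ₀ * v t + Real.sin θ₀ * w t, ⟨⟨?_, ?_⟩, ?_, ?_, ?_⟩, ?_, ?_, ?_, ?_, ?_⟩
  · exact (Real.measurable_arcsin.comp (by fun_prop)).aemeasurable
  · intro t _
    refine ⟨?_, Real.arcsin_le_pi_div_two _⟩
    rw [← Real.arcsin_sin (x := θ₀) (by linarith [hθ₀.1, Real.pi_pos]) hθ₀.2.le]
    exact Real.monotone_arcsin (le_max_left _ _)
  · fun_prop
  · exact fun t _ => le_max_left _ _
  · exact fun t _ => max_le (hk0 t) (min_le_right _ _)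
  · exact (hvL.const_mul _).add (hwL.const_mul _)
  · filter_upwards [hclamp, hw_le, hw_ge, hv_ge, hdisc] with t h1 h2 h3 h4 h5
    have h6 : v t ≤ Real.cos (θ' t) := by
      rw [h1, Real.cos_arcsin]
      exact Real.le_sqrt_of_sq_le (by linarith)
    have h7 : Real.sin (θ' t) = w t := by
      rw [h1, Real.sin_arcsin (by linarith) h2]
    have h8 : 0 ≤ Real.cos θ₀ :=
      Real.cos_nonneg_of_mem_Icc ⟨by linarith [hθ₀.1, Real.pi_pos], hθ₀.2.le⟩
    rw [Real.cos_sub, h7]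
    have := mul_le_mul_of_nonneg_left h6 h8
    linarith
  · exact hw'.congr_right hsin
  · have h1 := (hv'.bdd_mul (a := fun _ => Real.cos θ₀) (C := 1) aestronglyMeasurable_const
      (Eventually.of_forall fun t => Real.abs_cos_le_one _)).add
      (hw'.bdd_mul (a := fun _ => Real.sin θ₀) (C := 1) aestronglyMeasurable_const
      (Eventually.of_forall fun t => Real.abs_sin_le_one _)) (fun n => (hc _).const_mul _)
      (fun n => (hs _).const_mul _) (hvL.const_mul _) (hwL.const_mul _)
    have h2 : (fun (n : ℕ) t => Real.cos (θ (φ n) t - θ₀)) = fun n t =>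
        Real.cos θ₀ * Real.cos (θ (φ n) t) + Real.sin θ₀ * Real.sin (θ (φ n) t) := by
      ext n t
      rw [Real.cos_sub]
      ring
    rw [h2]
    exact h1
  · refine hg.congr_right ?_
    filter_upwards [hg_ge, hg_le] with t h1 h2
    rw [min_eq_left h2, max_eq_right h1]

lemma IsAngleControl.height_eq {θ : ℝ → ℝ} {t : ℝ} (ht : t ∈ Icc 0 S) :
    height θ t = ∫ s in Ioc 0 S, (Ioc 0 t).indicator (fun _ => (1 : ℝ)) s * Real.sin (θ s) := by
  have h1 : ∀ s, (Ioc 0 t).indicator (fun _ => (1 : ℝ)) s * Real.sin (θ s)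
      = (Ioc 0 t).indicator (fun s => Real.sin (θ s)) s := by
    intro s
    by_cases hs : s ∈ Ioc 0 t <;> simp [hs]
  simp only [h1]
  rw [setIntegral_indicator measurableSet_Ioc, inter_eq_right.2 (Ioc_subset_Ioc_right ht.2),
    height, intervalIntegral.integral_of_le ht.1]

lemma tendsto_height {θ : ℕ → ℝ → ℝ} {θ' : ℝ → ℝ}
    (h : WeakTendsto (volume.restrict (Ioc 0 S)) (fun n t => Real.sin (θ n t))
      (fun t => Real.sin (θ' t))) {t : ℝ} (ht : t ∈ Icc 0 S) :
    Tendsto (fun n => height (θ n) t) atTop (𝓝 (height θ' t)) := by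
  simp only [IsAngleControl.height_eq ht]
  exact h _ ((memLp_const (1 : ℝ)).indicator measurableSet_Ioc)

lemma tendsto_massBeyond (hS : 0 ≤ S) (hkS : ∀ t, S ≤ t → k t = 0)
    (hk : MemLp k 2 (volume.restrict (Ioc 0 S))) {θ u : ℕ → ℝ → ℝ} {θ' u' : ℝ → ℝ}
    (hθu : ∀ n, IsBoundedControl θ₀ k (θ n) (u n)) (hθu' : IsBoundedControl θ₀ k θ' u')
    (h : WeakTendsto (volume.restrict (Ioc 0 S)) u u') {t : ℝ} (ht : 0 ≤ t) :
    Tendsto (fun n => massBeyond (u n) t) atTop (𝓝 (massBeyond u' t)) := by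
  rw [hθu'.massBeyond_eq hS hkS hk ht]
  simp only [fun n => (hθu n).massBeyond_eq hS hkS hk ht]
  exact (ENNReal.continuous_ofReal.tendsto _).comp
    (h _ ((memLp_const (1 : ℝ)).indicator measurableSet_Ioi))

end

/-! ### Upper semicontinuity of the sunlight -/

section

variable {θ₀ : ℝ} {k : ℝ → ℝ} {S : ℝ} {I : ℝ → ℝ}

lemma IsAngleControl.aemeasurable_comp_height {θ : ℝ → ℝ} (h : IsAngleControl θ₀ θ)
    (hθ₀ : θ₀ ∈ Ioo 0 (Real.pi / 2)) (hI : MonotoneOn I (Ici 0)) :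
    AEMeasurable (fun t => I (height θ t)) (volume.restrict (Ioi 0)) :=
  aemeasurable_restrict_of_monotoneOn measurableSet_Ioi fun s hs t ht hst =>
    have hs0 : (0 : ℝ) ≤ s := le_of_lt hs
    have ht0 : (0 : ℝ) ≤ t := le_of_lt ht
    hI (h.height_nonneg hθ₀ hs0) (h.height_nonneg hθ₀ ht0)
      ((h.strictMonoOn_height hθ₀).monotoneOn hs0 ht0 hst)

lemma aemeasurable_gain {θ u : ℝ → ℝ} {μ : Measure ℝ} (hθ : AEMeasurable θ μ)
    (hu : AEMeasurable u μ) : AEMeasurable (fun t => gain θ₀ (θ t) (u t)) μ := by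
  unfold gain
  fun_prop

/-- A monotone `I` has countably many discontinuities, and the strictly increasing limit height
meets each of them at most once. -/
lemma IsAngleControl.tendsto_comp_height {θ : ℕ → ℝ → ℝ} {θ' : ℝ → ℝ}
    (hθ : ∀ n, IsAngleControl θ₀ (θ n)) (hθ' : IsAngleControl θ₀ θ')
    (hθ₀ : θ₀ ∈ Ioo 0 (Real.pi / 2)) (hI : MonotoneOn I (Ici 0))
    (h : ∀ t ∈ Ioc 0 S, Tendsto (fun n => height (θ n) t) atTop (𝓝 (height θ' t))) :
    ∀ᵐ t ∂volume.restrict (Ioc 0 S),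
      Tendsto (fun n => I (height (θ n) t)) atTop (𝓝 (I (height θ' t))) := by
  -- Extending `I` by the constant `I 0` makes it monotone on the whole line.
  set J : ℝ → ℝ := fun y => I (max 0 y) with hJ
  have hJm : Monotone J := fun x y hxy =>
    hI (mem_Ici.2 (le_max_left _ _)) (mem_Ici.2 (le_max_left _ _)) (max_le_max_left _ hxy)
  have hJI : ∀ {θ : ℝ → ℝ}, IsAngleControl θ₀ θ → ∀ t, 0 ≤ t → J (height θ t) = I (height θ t) := by
    intro θ hθ t ht
    rw [hJ]
    simp only
    rw [max_eq_right (hθ.height_nonneg hθ₀ ht)]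
  have hcount : (Ici 0 ∩ {t | ¬ContinuousAt J (height θ' t)}).Countable :=
    MapsTo.countable_of_injOn (t := {y | ¬ContinuousAt J y}) (f := height θ')
      (fun t ht => ht.2) ((hθ'.strictMonoOn_height hθ₀).injOn.mono inter_subset_left)
      hJm.countable_not_continuousAt
  filter_upwards [ae_restrict_mem measurableSet_Ioc, ae_restrict_of_ae (hcount.ae_notMem volume)]
    with t ht h1
  have h2 : ContinuousAt J (height θ' t) := by
    by_contra h3
    exact h1 ⟨ht.1.le, h3⟩
  have h3 := h2.tendsto.comp (h t ht)
  rw [hJI hθ' t ht.1.le] at h3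
  exact h3.congr fun n => hJI (hθ n) t ht.1.le

lemma IsBoundedControl.aemeasurable_integrand {θ u : ℝ → ℝ} (h : IsBoundedControl θ₀ k θ u)
    (hθ₀ : θ₀ ∈ Ioo 0 (Real.pi / 2)) (hI : MonotoneOn I (Ici 0)) :
    AEMeasurable (fun t => I (height θ t) * gain θ₀ (θ t) (u t)) (volume.restrict (Ioi 0)) :=
  (h.angle.aemeasurable_comp_height hθ₀ hI).mul
    (aemeasurable_gain h.angle.aemeasurable h.aemeasurable)

lemma IsBoundedControl.integrable_integrand {θ u : ℝ → ℝ} (h : IsBoundedControl θ₀ k θ u)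
    (hθ₀ : θ₀ ∈ Ioo 0 (Real.pi / 2)) (hI : MonotoneOn I (Ici 0))
    (hI_mem : ∀ y, 0 ≤ y → I y ∈ Icc (0 : ℝ) 1) :
    IntegrableOn (fun t => I (height θ t) * gain θ₀ (θ t) (u t)) (Ioc 0 S) := by
  refine Integrable.of_bound (C := 1) ((h.aemeasurable_integrand hθ₀ hI).mono_measure
    (Measure.restrict_mono Ioc_subset_Ioi_self le_rfl)).aestronglyMeasurable ?_
  filter_upwards [ae_restrict_mem measurableSet_Ioc] with t ht
  have h1 := hI_mem _ (h.angle.height_nonneg hθ₀ ht.1.le)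
  have h2 := gain_nonneg hθ₀ (h.angle.mem_Icc t ht.1.le) (h.nonneg t ht.1.le)
  rw [Real.norm_eq_abs, abs_of_nonneg (mul_nonneg h1.1 h2)]
  exact mul_le_one₀ h1.2 h2 (gain_le_one hθ₀ (h.angle.mem_Icc t ht.1.le) _)

lemma IsBoundedControl.sunlight_eq {θ u : ℝ → ℝ} (h : IsBoundedControl θ₀ k θ u) (hS : 0 ≤ S)
    (hkS : ∀ t, S ≤ t → k t = 0) (hθ₀ : θ₀ ∈ Ioo 0 (Real.pi / 2)) (hI : MonotoneOn I (Ici 0))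
    (hI_mem : ∀ y, 0 ≤ y → I y ∈ Icc (0 : ℝ) 1) :
    sunlight I θ₀ θ u
      = ENNReal.ofReal (∫ t in Ioc 0 S, I (height θ t) * gain θ₀ (θ t) (u t)) := by
  rw [ofReal_integral_eq_lintegral_ofReal (h.integrable_integrand hθ₀ hI hI_mem), sunlight,
    ← Ioc_union_Ioi_eq_Ioi hS]
  · refine le_antisymm ((lintegral_union_le _ _ _).trans_eq ?_)
      (lintegral_mono_set subset_union_left)
    have h1 : ∫⁻ t in Ioi S, ENNReal.ofReal (I (height θ t) * gain θ₀ (θ t) (u t)) = 0 := by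
      refine setLIntegral_eq_zero measurableSet_Ioi fun t ht => ?_
      simp [h.density_eq_zero hS hkS (le_of_lt ht), gain_zero]
    rw [h1, add_zero]
  · filter_upwards [ae_restrict_mem measurableSet_Ioc] with t ht
    exact mul_nonneg (hI_mem _ (h.angle.height_nonneg hθ₀ ht.1.le)).1
      (gain_nonneg hθ₀ (h.angle.mem_Icc t ht.1.le) (h.nonneg t ht.1.le))

/-- Upper semicontinuity of the gathered sunlight along weakly convergent controls. -/
lemma exists_sunlight_bound (hθ₀ : θ₀ ∈ Ioo 0 (Real.pi / 2)) (hI : MonotoneOn I (Ici 0))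
    (hI_mem : ∀ y, 0 ≤ y → I y ∈ Icc (0 : ℝ) 1)
    (hk : MemLp k 2 (volume.restrict (Ioc 0 S))) {θ u : ℕ → ℝ → ℝ} {θ' u' q : ℝ → ℝ}
    (hθu : ∀ n, IsBoundedControl θ₀ k (θ n) (u n)) (hθu' : IsBoundedControl θ₀ k θ' u')
    (hq : MemLp q 2 (volume.restrict (Ioc 0 S)))
    (hqle : ∀ᵐ t ∂volume.restrict (Ioc 0 S), q t ≤ Real.cos (θ' t - θ₀))
    (hs : WeakTendsto (volume.restrict (Ioc 0 S)) (fun n t => Real.sin (θ n t))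
      (fun t => Real.sin (θ' t)))
    (hc : WeakTendsto (volume.restrict (Ioc 0 S)) (fun n t => Real.cos (θ n t - θ₀)) q)
    (hu : WeakTendsto (volume.restrict (Ioc 0 S)) u u') :
    ∃ (A : ℕ → ℝ) (B : ℝ),
      (∀ n, ∫ t in Ioc 0 S, I (height (θ n) t) * gain θ₀ (θ n t) (u n t) ≤ A n) ∧
      Tendsto A atTop (𝓝 B) ∧
      B ≤ ∫ t in Ioc 0 S, I (height θ' t) * gain θ₀ (θ' t) (u' t) := by
  set μ := volume.restrict (Ioc 0 S) with hμ
  have hle : μ ≤ volume.restrict (Ioi 0) := Measure.restrict_mono Ioc_subset_Ioi_self le_rfl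
  have hpos : ∀ᵐ t ∂μ, 0 < t := (ae_restrict_mem measurableSet_Ioc).mono fun t ht => ht.1
  -- The tangent plane is taken at the limit control: it touches the gain there and is linear in
  -- `(cos (θₙ - θ₀), uₙ)`, so its integral converges weakly.
  set x : ℝ → ℝ := fun t => u' t / Real.cos (θ' t - θ₀) with hx
  have hxm : AEMeasurable x μ := (hθu'.aemeasurable.mono_measure hle).div
    (Real.measurable_cos.comp_aemeasurable ((hθu'.angle.aemeasurable.mono_measure hle).sub_const _))
  have hx0 : ∀ t, 0 < t → 0 ≤ x t := fun t ht => div_nonneg (hθu'.nonneg t ht.le)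
    (cos_sub_pos hθ₀ (hθu'.angle.mem_Icc t ht.le)).le
  have hIm : ∀ {θ : ℝ → ℝ}, IsAngleControl θ₀ θ → AEMeasurable (fun t => I (height θ t)) μ :=
    fun hθ => (hθ.aemeasurable_comp_height hθ₀ hI).mono_measure hle
  have hI1 : ∀ {θ : ℝ → ℝ}, IsAngleControl θ₀ θ → ∀ t, 0 < t → I (height θ t) ∈ Icc (0 : ℝ) 1 :=
    fun hθ t ht => hI_mem _ (hθ.height_nonneg hθ₀ ht.le)
  set a : ℝ → ℝ := fun t => I (height θ' t) * slope (x t) with ha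
  set b : ℝ → ℝ := fun t => I (height θ' t) * Real.exp (-x t) with hb
  have haL : MemLp a 2 μ := by
    refine MemLp.of_bound ((hIm hθu'.angle).mul
      (measurable_slope.comp_aemeasurable hxm)).aestronglyMeasurable 1 ?_
    filter_upwards [hpos] with t ht
    rw [Real.norm_eq_abs, abs_of_nonneg (mul_nonneg (hI1 hθu'.angle t ht).1 (slope_nonneg _))]
    exact mul_le_one₀ (hI1 hθu'.angle t ht).2 (slope_nonneg _) (slope_le_one (hx0 t ht))
  have hbL : MemLp b 2 μ := by
    refine MemLp.of_bound ((hIm hθu'.angle).mul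
      (Real.measurable_exp.comp_aemeasurable hxm.neg)).aestronglyMeasurable 1 ?_
    filter_upwards [hpos] with t ht
    rw [Real.norm_eq_abs,
      abs_of_nonneg (mul_nonneg (hI1 hθu'.angle t ht).1 (Real.exp_pos _).le)]
    exact mul_le_one₀ (hI1 hθu'.angle t ht).2 (Real.exp_pos _).le
      (Real.exp_le_one_iff.2 (neg_nonpos.2 (hx0 t ht)))
  have hcL : ∀ {θ : ℝ → ℝ}, IsAngleControl θ₀ θ → MemLp (fun t => Real.cos (θ t - θ₀)) 2 μ :=
    fun hθ => hθ.memLp_comp (by fun_prop : Measurable fun x : ℝ => Real.cos (x - θ₀))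
      fun _ => Real.abs_cos_le_one _
  have hdiff_le : ∀ n t, 0 < t → |I (height (θ n) t) - I (height θ' t)| ≤ 1 := by
    intro n t ht
    have h1 := hI1 (hθu n).angle t ht
    have h2 := hI1 hθu'.angle t ht
    exact abs_sub_le_iff.2 ⟨by linarith [h1.2, h2.1], by linarith [h1.1, h2.2]⟩
  have hdiffm : ∀ n, AEStronglyMeasurable (fun t => |I (height (θ n) t) - I (height θ' t)|) μ :=
    fun n => (continuous_abs.measurable.comp_aemeasurable
      ((hIm (hθu n).angle).sub (hIm hθu'.angle))).aestronglyMeasurable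
  have hdiff_int : ∀ n, Integrable (fun t => |I (height (θ n) t) - I (height θ' t)|) μ := fun n =>
    Integrable.of_bound (C := 1) (hdiffm n) <| hpos.mono fun t ht => by
      rw [Real.norm_eq_abs, abs_abs]
      exact hdiff_le n t ht
  have hdiff : Tendsto (fun n => ∫ t, |I (height (θ n) t) - I (height θ' t)| ∂μ) atTop (𝓝 0) := by
    have h1 := IsAngleControl.tendsto_comp_height (fun n => (hθu n).angle) hθu'.angle hθ₀ hI
      (fun t ht => tendsto_height hs ⟨ht.1.le, ht.2⟩)
    have h2 := tendsto_integral_of_dominated_convergence (μ := μ) (f := fun _ => (0 : ℝ))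
      (fun _ => (1 : ℝ)) hdiffm (integrable_const _) (fun n => hpos.mono fun t ht => by
        rw [Real.norm_eq_abs, abs_abs]
        exact hdiff_le n t ht) (h1.mono fun t ht => by
        simpa using (ht.sub_const (I (height θ' t))).abs)
    simpa using h2
  refine ⟨fun n => ∫ t, |I (height (θ n) t) - I (height θ' t)| ∂μ +
    (∫ t, a t * Real.cos (θ n t - θ₀) ∂μ + ∫ t, b t * u n t ∂μ),
    0 + (∫ t, a t * q t ∂μ + ∫ t, b t * u' t ∂μ), fun n => ?_,
    hdiff.add ((hc a haL).add (hu b hbL)), ?_⟩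
  · have h1 : Integrable (fun t => a t * Real.cos (θ n t - θ₀)) μ :=
      haL.integrable_mul (hcL (hθu n).angle)
    have h2 : Integrable (fun t => b t * u n t) μ := hbL.integrable_mul ((hθu n).memLp_density hk)
    have h12 : Integrable (fun t => a t * Real.cos (θ n t - θ₀) + b t * u n t) μ := h1.add h2
    beta_reduce
    rw [← integral_add h1 h2, ← integral_add (hdiff_int n) h12]
    refine integral_mono_ae ((hθu n).integrable_integrand hθ₀ hI hI_mem)
      ((hdiff_int n).add h12) ?_
    filter_upwards [hpos] with t ht
    have h3 := hI1 hθu'.angle t ht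
    have hmem := (hθu n).angle.mem_Icc t ht.le
    have h4 := gain_nonneg hθ₀ hmem ((hθu n).nonneg t ht.le)
    have h5 := gain_le_one hθ₀ hmem (u n t)
    have h6 := mul_le_mul_of_nonneg_left (gain_le_slope hθ₀ hmem (u n t) (x t)) h3.1
    have h7 : (I (height (θ n) t) - I (height θ' t)) * gain θ₀ (θ n t) (u n t)
        ≤ |I (height (θ n) t) - I (height θ' t)| :=
      (mul_le_mul_of_nonneg_right (le_abs_self _) h4).trans
        (mul_le_of_le_one_right (abs_nonneg _) h5)
    simp only [ha, hb]
    linarith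
  · have h1 : Integrable (fun t => a t * q t) μ := haL.integrable_mul hq
    have h2 : Integrable (fun t => b t * u' t) μ := hbL.integrable_mul (hθu'.memLp_density hk)
    rw [zero_add, ← integral_add h1 h2]
    refine integral_mono_ae (h1.add h2) (hθu'.integrable_integrand hθ₀ hI hI_mem) ?_
    filter_upwards [hpos, hqle] with t ht h3
    have h4 := hI1 hθu'.angle t ht
    -- Nonnegativity of the slope is what lets `q` be replaced by the larger `cos (θ' - θ₀)`.
    have h5 := mul_le_mul_of_nonneg_left h3 (mul_nonneg h4.1 (slope_nonneg (x t)))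
    rw [gain_eq_slope hθ₀ (hθu'.angle.mem_Icc t ht.le)]
    simp only [ha, hb]
    linarith

end

section

/-! ### Existence of an optimal control with bounded leaf density -/

section

variable {θ₀ : ℝ} {k : ℝ → ℝ} {S : ℝ} {I : ℝ → ℝ} {α c : ℝ}

/-- An upper bound for the tails of leaf densities dominated by `k`. -/
def tailBound (k : ℝ → ℝ) (S : ℝ) (t : ℝ) : ℝ≥0∞ :=
  (Iic S).indicator (fun _ => massBeyond k 0) t

lemma IsBoundedControl.massBeyond_le {θ u : ℝ → ℝ} (h : IsBoundedControl θ₀ k θ u) (hS : 0 ≤ S)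
    (hkS : ∀ t, S ≤ t → k t = 0) {t : ℝ} (ht : 0 ≤ t) : massBeyond u t ≤ tailBound k S t := by
  unfold tailBound
  by_cases hts : t ∈ Iic S
  · rw [indicator_of_mem hts]
    refine (setLIntegral_mono' measurableSet_Ioi fun s hs => ?_).trans (antitone_massBeyond k ht)
    exact ENNReal.ofReal_le_ofReal (h.le s (ht.trans (le_of_lt hs)))
  · rw [indicator_of_notMem hts, nonpos_iff_eq_zero]
    refine setLIntegral_eq_zero measurableSet_Ioi fun s hs => ?_
    simp [h.density_eq_zero hS hkS ((not_le.1 hts).le.trans (le_of_lt hs))]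

lemma irrigationCost_tailBound_ne_top (hα : 0 < α) (hk : IntegrableOn k (Ioi 0)) :
    irrigationCost α (tailBound k S) ≠ ∞ := by
  have h1 : massBeyond k 0 ≠ ∞ := hk.lintegral_lt_top.ne
  have h2 : ∀ t, tailBound k S t ^ α = (Iic S).indicator (fun _ => massBeyond k 0 ^ α) t := by
    intro t
    unfold tailBound
    by_cases ht : t ∈ Iic S
    · simp [ht]
    · simp only [indicator_of_notMem ht, ENNReal.zero_rpow_of_pos hα]
  unfold irrigationCost
  simp only [h2]
  rw [lintegral_indicator measurableSet_Iic, setLIntegral_const,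
    Measure.restrict_apply measurableSet_Iic, inter_comm, Ioi_inter_Iic, Real.volume_Ioc]
  exact ENNReal.mul_ne_top (ENNReal.rpow_ne_top_of_nonneg hα.le h1) ENNReal.ofReal_ne_top

lemma IsBoundedControl.irrigationCost_ne_top {θ u : ℝ → ℝ} (h : IsBoundedControl θ₀ k θ u)
    (hα : 0 < α) (hS : 0 ≤ S) (hkS : ∀ t, S ≤ t → k t = 0) (hk : IntegrableOn k (Ioi 0)) :
    irrigationCost α (massBeyond u) ≠ ∞ :=
  ne_top_of_le_ne_top (irrigationCost_tailBound_ne_top (S := S) hα hk)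
    (setLIntegral_mono' measurableSet_Ioi fun _ ht =>
      ENNReal.rpow_le_rpow (h.massBeyond_le hS hkS (le_of_lt ht)) hα.le)

/-- Dominated convergence: tails converge pointwise, are bounded by the mass of `k`, and vanish
beyond `S`. -/
lemma tendsto_irrigationCost (hα : 0 < α) (hS : 0 ≤ S) (hkS : ∀ t, S ≤ t → k t = 0)
    (hk : MemLp k 2 (volume.restrict (Ioc 0 S))) (hk1 : IntegrableOn k (Ioi 0))
    {θ u : ℕ → ℝ → ℝ} {θ' u' : ℝ → ℝ}
    (hθu : ∀ n, IsBoundedControl θ₀ k (θ n) (u n)) (hθu' : IsBoundedControl θ₀ k θ' u')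
    (h : WeakTendsto (volume.restrict (Ioc 0 S)) u u') :
    Tendsto (fun n => irrigationCost α (massBeyond (u n))) atTop
      (𝓝 (irrigationCost α (massBeyond u'))) := by
  refine tendsto_lintegral_of_dominated_convergence (fun t => tailBound k S t ^ α)
    (fun n => (antitone_massBeyond _).measurable.pow_const α) (fun n => ?_)
    (irrigationCost_tailBound_ne_top hα hk1) ?_
  · filter_upwards [ae_restrict_mem measurableSet_Ioi] with t ht
    exact ENNReal.rpow_le_rpow ((hθu n).massBeyond_le hS hkS (le_of_lt ht)) hα.le
  · filter_upwards [ae_restrict_mem measurableSet_Ioi] with t ht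
    exact (ENNReal.continuous_rpow_const.tendsto _).comp
      (tendsto_massBeyond hS hkS hk hθu hθu' h (le_of_lt ht))

lemma coe_ofReal_sub_coe {s : ℝ} {C : ℝ≥0∞} (hs : 0 ≤ s) (hc : 0 ≤ c) (hC : C ≠ ∞) :
    ((ENNReal.ofReal s : ℝ≥0∞) : EReal) - ((ENNReal.ofReal c * C : ℝ≥0∞) : EReal)
      = ((s - c * C.toReal : ℝ) : EReal) := by
  rw [← ENNReal.ofReal_toReal hC, ← ENNReal.ofReal_mul hc, EReal.coe_ennreal_ofReal,
    EReal.coe_ennreal_ofReal, max_eq_left hs, max_eq_left (mul_nonneg hc ENNReal.toReal_nonneg),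
    ENNReal.ofReal_toReal hC]
  rfl

lemma isAngleControl_const (hθ₀ : θ₀ ∈ Ioo 0 (Real.pi / 2)) :
    IsAngleControl θ₀ fun _ => θ₀ :=
  ⟨aemeasurable_const, fun _ _ => ⟨le_rfl, hθ₀.2.le⟩⟩

lemma exists_maximizer (hα : 0 < α) (hc : 0 < c) (hθ₀ : θ₀ ∈ Ioo 0 (Real.pi / 2))
    (hI : MonotoneOn I (Ici 0)) (hI_mem : ∀ y, 0 ≤ y → I y ∈ Icc (0 : ℝ) 1)
    (hk0 : ∀ t, 0 ≤ k t) (hkm : Measurable k) (hS : 0 ≤ S) (hkS : ∀ t, S ≤ t → k t = 0)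
    (hk : MemLp k 2 (volume.restrict (Ioc 0 S))) (hk1 : IntegrableOn k (Ioi 0)) :
    ∃ θ u : ℝ → ℝ, IsBoundedControl θ₀ k θ u ∧ ∀ θ' u' : ℝ → ℝ, IsBoundedControl θ₀ k θ' u' →
      payoff I α c θ₀ θ' u' (massBeyond u') ≤ payoff I α c θ₀ θ u (massBeyond u) := by
  set P : Set EReal := {x | ∃ θ u : ℝ → ℝ, IsBoundedControl θ₀ k θ u ∧
    payoff I α c θ₀ θ u (massBeyond u) = x} with hP
  have hne : P.Nonempty := ⟨_, fun _ => θ₀, fun _ => 0, ⟨isAngleControl_const hθ₀,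
    aemeasurable_const, fun _ _ => le_rfl, fun t _ => hk0 t⟩, rfl⟩
  obtain ⟨x, -, hx, hxP⟩ := exists_seq_tendsto_sSup hne (OrderTop.bddAbove P)
  choose θ u hθu hpay using hxP
  obtain ⟨φ, hφ, θ', u', q, hθu', hqL, hq, hs, hcos, hu⟩ :=
    exists_limit_control hθ₀ hk0 hkm hk hθu
  refine ⟨θ', u', hθu', fun θ₁ u₁ h₁ => (le_sSup (s := P) ⟨θ₁, u₁, h₁, rfl⟩).trans ?_⟩
  obtain ⟨A, B, hA, hAB, hB⟩ := exists_sunlight_bound hθ₀ hI hI_mem hk (fun n => hθu (φ n)) hθu'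
    hqL hq hs hcos hu
  -- For dominated controls both terms are finite, so limits can be taken in `ℝ`.
  have hform : ∀ {θ u : ℝ → ℝ}, IsBoundedControl θ₀ k θ u →
      payoff I α c θ₀ θ u (massBeyond u)
        = (((∫ t in Ioc 0 S, I (height θ t) * gain θ₀ (θ t) (u t))
          - c * (irrigationCost α (massBeyond u)).toReal : ℝ) : EReal) := by
    intro θ u h
    rw [payoff, h.sunlight_eq hS hkS hθ₀ hI hI_mem]
    refine coe_ofReal_sub_coe ?_ hc.le (h.irrigationCost_ne_top hα hS hkS hk1)
    refine setIntegral_nonneg measurableSet_Ioc fun t ht => ?_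
    exact mul_nonneg (hI_mem _ (h.angle.height_nonneg hθ₀ ht.1.le)).1
      (gain_nonneg hθ₀ (h.angle.mem_Icc t ht.1.le) (h.nonneg t ht.1.le))
  have hcost := (ENNReal.tendsto_toReal (hθu'.irrigationCost_ne_top hα hS hkS hk1)).comp
    (tendsto_irrigationCost hα hS hkS hk hk1 (fun n => hθu (φ n)) hθu' hu)
  have hlim : Tendsto (fun n =>
      ((A n - c * (irrigationCost α (massBeyond (u (φ n)))).toReal : ℝ) : EReal)) atTop
      (𝓝 ((B - c * (irrigationCost α (massBeyond u')).toReal : ℝ) : EReal)) :=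
    (continuous_coe_real_ereal.tendsto _).comp (hAB.sub (hcost.const_mul c))
  refine (le_of_tendsto_of_tendsto' (hx.comp hφ.tendsto_atTop) hlim fun n => ?_).trans ?_
  · rw [Function.comp_apply, ← hpay, hform (hθu (φ n)), EReal.coe_le_coe_iff]
    linarith [hA n]
  · rw [hform hθu', EReal.coe_le_coe_iff]
    linarith

end

/-! ### General leaf measures -/

section

variable {θ₀ α c : ℝ} {I θ u : ℝ → ℝ}

lemma densityMeasure_Ioi (u : ℝ → ℝ) {t : ℝ} (ht : 0 ≤ t) :
    densityMeasure u (Ioi t) = massBeyond u t := by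
  rw [densityMeasure, withDensity_apply _ measurableSet_Ioi,
    Measure.restrict_restrict measurableSet_Ioi, inter_eq_left.2 (Ioi_subset_Ioi ht), massBeyond]

lemma densityMeasure_restrict_absolutelyContinuous (u : ℝ → ℝ) :
    (densityMeasure u).restrict (Ioi 0) ≪ volume :=
  Measure.restrict_le_self.absolutelyContinuous.trans
    ((withDensity_absolutelyContinuous _ _).trans Measure.restrict_le_self.absolutelyContinuous)

lemma isFiniteMeasure_densityMeasure (hu : IntegrableOn u (Ioi 0)) :
    IsFiniteMeasure (densityMeasure u) :=
  isFiniteMeasure_withDensity_ofReal hu.2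

lemma measurePayoff_densityMeasure (hu : AEMeasurable u (volume.restrict (Ioi 0)))
    (hu0 : ∀ t, 0 ≤ t → 0 ≤ u t) :
    measurePayoff I α c θ₀ θ (densityMeasure u) = payoff I α c θ₀ θ u (massBeyond u) := by
  have h1 : (densityMeasure u).rnDeriv volume =ᵐ[volume]
      (Ioi 0).indicator fun t => ENNReal.ofReal (u t) := by
    rw [densityMeasure, ← withDensity_indicator measurableSet_Ioi]
    exact Measure.rnDeriv_withDensity₀ _
      ((aemeasurable_indicator_iff measurableSet_Ioi).2 hu.ennreal_ofReal)
  have h2 : sunlight I θ₀ θ (fun t => ((densityMeasure u).rnDeriv volume t).toReal)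
      = sunlight I θ₀ θ u := by
    refine lintegral_congr_ae ?_
    filter_upwards [ae_restrict_of_ae h1, ae_restrict_mem measurableSet_Ioi] with t ht ht0
    rw [ht, indicator_of_mem ht0, ENNReal.toReal_ofReal (hu0 t (le_of_lt ht0))]
  have h3 : irrigationCost α (fun t => densityMeasure u (Ioi t))
      = irrigationCost α (massBeyond u) :=
    setLIntegral_congr_fun measurableSet_Ioi fun t ht => by
      simp only
      rw [densityMeasure_Ioi u (le_of_lt ht)]
  rw [measurePayoff, payoff, payoff, h2, h3]

variable {ν : Measure ℝ}

lemma massBeyond_rnDeriv (ν : Measure ℝ) [IsFiniteMeasure ν] (t : ℝ) :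
    massBeyond (fun t => (ν.rnDeriv volume t).toReal) t = ∫⁻ s in Ioi t, ν.rnDeriv volume s := by
  refine lintegral_congr_ae (ae_restrict_of_ae ?_)
  filter_upwards [ν.rnDeriv_lt_top volume] with s hs
  exact ENNReal.ofReal_toReal hs.ne

lemma massBeyond_rnDeriv_le (ν : Measure ℝ) [IsFiniteMeasure ν] (t : ℝ) :
    massBeyond (fun t => (ν.rnDeriv volume t).toReal) t ≤ ν (Ioi t) := by
  rw [massBeyond_rnDeriv]
  exact Measure.setLIntegral_rnDeriv_le _

lemma isDensityControl_rnDeriv (ν : Measure ℝ) [IsFiniteMeasure ν] :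
    IsDensityControl fun t => (ν.rnDeriv volume t).toReal where
  aemeasurable := (Measure.measurable_rnDeriv ν volume).ennreal_toReal.aemeasurable
  nonneg _ _ := ENNReal.toReal_nonneg
  tendsto_massBeyond := by
    refine tendsto_of_tendsto_of_tendsto_of_le_of_le tendsto_const_nhds ?_ (fun _ => zero_le)
      (massBeyond_rnDeriv_le ν)
    have h := tendsto_measure_iInter_atTop (μ := ν) (s := fun t : ℝ => Ioi t)
      (fun t => measurableSet_Ioi.nullMeasurableSet) (fun s t hst => Ioi_subset_Ioi hst)
      ⟨0, measure_ne_top _ _⟩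
    have h0 : ⋂ t : ℝ, Ioi t = ∅ := eq_empty_of_forall_notMem fun x hx =>
      lt_irrefl x (mem_iInter.1 hx x)
    rwa [h0, measure_empty] at h

/-- Dropping the singular part of a leaf measure does not decrease the payoff. -/
lemma measurePayoff_le (hα : 0 < α) (ν : Measure ℝ) [IsFiniteMeasure ν] :
    measurePayoff I α c θ₀ θ ν ≤ payoff I α c θ₀ θ (fun t => (ν.rnDeriv volume t).toReal)
      (massBeyond fun t => (ν.rnDeriv volume t).toReal) := by
  refine EReal.sub_le_sub le_rfl ?_
  rw [EReal.coe_ennreal_le_coe_ennreal_iff]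
  exact mul_le_mul_right (lintegral_mono fun t =>
    ENNReal.rpow_le_rpow (massBeyond_rnDeriv_le ν t) hα.le) _

/-- A nonzero singular part charges some `(ε, ∞)`, so removing it strictly lowers every tail with `t
< ε`, a set of positive length. -/
lemma irrigationCost_rnDeriv_lt (hα : 0 < α) (ν : Measure ℝ) [IsFiniteMeasure ν]
    (hcost : irrigationCost α (fun t => ν (Ioi t)) ≠ ∞)
    (hs : ν.singularPart volume (Ioi 0) ≠ 0) :
    irrigationCost α (massBeyond fun t => (ν.rnDeriv volume t).toReal)
      < irrigationCost α (fun t => ν (Ioi t)) := by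
  have hanti : Antitone fun t => ν (Ioi t) := fun s t hst => measure_mono (Ioi_subset_Ioi hst)
  obtain ⟨ε, hε, hsε⟩ : ∃ ε : ℝ, 0 < ε ∧ ν.singularPart volume (Ioi ε) ≠ 0 := by
    by_contra! h
    refine hs (measure_mono_null (t := ⋃ n : ℕ, Ioi (1 / ((n : ℝ) + 1))) (fun x hx => ?_)
      (measure_iUnion_null fun n => h _ (by positivity)))
    obtain ⟨n, hn⟩ := exists_nat_one_div_lt (mem_Ioi.1 hx)
    exact mem_iUnion.2 ⟨n, hn⟩
  have hle : ∀ t, massBeyond (fun t => (ν.rnDeriv volume t).toReal) t ^ α ≤ ν (Ioi t) ^ α :=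
    fun t => ENNReal.rpow_le_rpow (massBeyond_rnDeriv_le ν t) hα.le
  refine lintegral_strict_mono_of_ae_le_of_ae_lt_on (s := Ioo 0 ε)
    (hanti.measurable.pow_const α).aemeasurable
    (ne_top_of_le_ne_top hcost (lintegral_mono hle)) (Eventually.of_forall hle) ?_
    (Eventually.of_forall fun t ht => ENNReal.rpow_lt_rpow ?_ hα)
  · rw [Measure.restrict_apply measurableSet_Ioo, inter_eq_left.2 Ioo_subset_Ioi_self,
      Real.volume_Ioo]
    simpa using hε
  · have hdec := congrArg (fun m => m (Ioi t)) (ν.haveLebesgueDecomposition_add volume)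
    simp only [Measure.add_apply, withDensity_apply _ measurableSet_Ioi] at hdec
    have hpos : ν.singularPart volume (Ioi t) ≠ 0 := fun h0 =>
      hsε (measure_mono_null (Ioi_subset_Ioi ht.2.le) h0)
    change _ < ν (Ioi t)
    rw [hdec, massBeyond_rnDeriv, add_comm]
    refine ENNReal.lt_add_right ?_ hpos
    exact ne_top_of_le_ne_top (measure_ne_top ν (Ioi t)) (Measure.setLIntegral_rnDeriv_le _)

/-- An optimal leaf measure is absolutely continuous with respect to the arc-length parameter. -/
lemma IsOptimalLeafMeasure.restrict_absolutelyContinuous (hα : 0 < α) (hc : 0 < c)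
    (hθ₀ : θ₀ ∈ Ioo 0 (Real.pi / 2)) (hI_mem : ∀ y, 0 ≤ y → I y ∈ Icc (0 : ℝ) 1)
    (h : IsOptimalLeafMeasure I α c θ₀ θ ν) : ν.restrict (Ioi 0) ≪ volume := by
  have := h.finite
  set v : ℝ → ℝ := fun t => (ν.rnDeriv volume t).toReal with hv
  have hvc : IsDensityControl v := isDensityControl_rnDeriv ν
  have h0 : 0 ≤ measurePayoff I α c θ₀ θ ν := by
    -- The zero measure is a competitor, which forces the optimal cost to be finite.
    refine le_trans ?_ (h.maximal θ 0 h.angle inferInstance)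
    simpa [measurePayoff] using payoff_zero_nonneg I hα c θ₀ θ _
  have hcost : irrigationCost α (fun t => ν (Ioi t)) ≠ ∞ := by
    intro h1
    refine (le_of_coe_sub_coe_nonneg h0).2 ?_
    rw [h1, ENNReal.mul_top (by simpa using hc)]
  have hsing : ν.singularPart volume (Ioi 0) = 0 := by
    by_contra hs
    have h1 := irrigationCost_rnDeriv_lt hα ν hcost hs
    -- The competitor is the absolutely continuous part: same finite sunlight, strictly smaller
    -- cost.
    have h2 := h.maximal θ (densityMeasure v) h.angle
      (isFiniteMeasure_densityMeasure Measure.integrable_toReal_rnDeriv.integrableOn)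
    rw [measurePayoff_densityMeasure hvc.aemeasurable hvc.nonneg] at h2
    have h3 : sunlight I θ₀ θ v ≠ ∞ := by
      refine ne_top_of_le_ne_top ?_ (sunlight_le hθ₀ hI_mem h.angle hvc.nonneg le_rfl)
      rw [ENNReal.ofReal_zero, zero_add]
      exact ne_top_of_le_ne_top (measure_ne_top ν _) (massBeyond_rnDeriv_le ν 0)
    obtain ⟨X, hX0, hX⟩ : ∃ r : ℝ, 0 ≤ r ∧ sunlight I θ₀ θ v = ENNReal.ofReal r :=
      ⟨_, ENNReal.toReal_nonneg, (ENNReal.ofReal_toReal h3).symm⟩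
    rw [measurePayoff, payoff, payoff, ← hv, hX, coe_ofReal_sub_coe hX0 hc.le h1.ne_top,
      coe_ofReal_sub_coe hX0 hc.le hcost, EReal.coe_le_coe_iff] at h2
    have h4 := mul_lt_mul_of_pos_left ((ENNReal.toReal_lt_toReal h1.ne_top hcost).2 h1) hc
    linarith
  rw [ν.haveLebesgueDecomposition_add volume, Measure.restrict_add,
    Measure.restrict_eq_zero.2 hsing, zero_add]
  exact Measure.restrict_le_self.absolutelyContinuous.trans (withDensity_absolutelyContinuous _ _)

end

end

/-! ### Optimality among all densities and all finite measures -/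

section

variable {I : ℝ → ℝ} {α c θ₀ : ℝ}

/-- The optimal control in the class of controls with leaf density at most `cap α c` is optimal
among all density controls. -/
lemma exists_isSolutionOP2 (hα : α ∈ Ioo (0 : ℝ) 1) (hc : 0 < c)
    (hθ₀ : θ₀ ∈ Ioo 0 (Real.pi / 2)) (hI : MonotoneOn I (Ici 0))
    (hI_mem : ∀ y, 0 ≤ y → I y ∈ Icc (0 : ℝ) 1) :
    ∃ θ u : ℝ → ℝ, IsSolutionOP2 I α c θ₀ θ u ∧ IntegrableOn u (Ioi 0) := by
  have hS := (capSupport_pos hα.1 hc).le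
  have hkS : ∀ t, capSupport α c ≤ t → cap α c t = 0 := fun t ht => cap_eq_zero hα.1 hc ht
  have hk1 := integrableOn_cap hα.1 hc
  obtain ⟨θ, u, hθu, hmax⟩ := exists_maximizer hα.1 hc hθ₀ hI hI_mem (cap_nonneg α c)
    (measurable_cap α c) hS hkS (memLp_cap hα.1 hc _) hk1
  refine ⟨θ, u, ⟨hθu.angle, ⟨hθu.aemeasurable, hθu.nonneg, ?_⟩, fun θ' u' hθ' hu' => ?_⟩,
    hθu.integrableOn_density hk1⟩
  · refine tendsto_const_nhds.congr' ?_
    filter_upwards [eventually_ge_atTop (capSupport α c)] with t ht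
    refine (setLIntegral_eq_zero measurableSet_Ioi fun s hs => ?_).symm
    simp [hθu.density_eq_zero hS hkS (ht.trans (le_of_lt hs))]
  -- Truncation applies to nonnegative payoffs; any other control is beaten by the bare stem, which
  -- is itself a capped control.
  · rcases le_total 0 (payoff I α c θ₀ θ' u' (massBeyond u')) with h | h
    · exact (payoff_le_payoff_truncate hα hc hθ₀ hI_mem hθ' hu' h).trans
        (hmax _ _ ⟨hθ', (hu'.truncate α c).aemeasurable, (hu'.truncate α c).nonneg,
          fun _ _ => min_le_right _ _⟩)
    · refine (h.trans ?_).trans (hmax θ' (fun _ => 0) ⟨hθ', aemeasurable_const,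
        fun _ _ => le_rfl, fun t _ => cap_nonneg _ _ _⟩)
      have h0 : massBeyond (fun _ => 0) = fun _ => 0 := by
        ext t
        simp [massBeyond]
      rw [h0]
      exact payoff_zero_nonneg I hα.1 c θ₀ θ' _

/-- Every finite measure is dominated by its absolutely continuous part, whose density is admissible
in (OP2). -/
lemma IsSolutionOP2.isOptimalLeafMeasure {θ u : ℝ → ℝ} (h : IsSolutionOP2 I α c θ₀ θ u)
    (hα : 0 < α) (hu : IntegrableOn u (Ioi 0)) :
    IsOptimalLeafMeasure I α c θ₀ θ (densityMeasure u) where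
  angle := h.angle
  finite := isFiniteMeasure_densityMeasure hu
  maximal θ' ν' hθ' hν' := by
    rw [measurePayoff_densityMeasure h.density.aemeasurable h.density.nonneg]
    exact (measurePayoff_le hα ν').trans (h.maximal _ _ hθ' (isDensityControl_rnDeriv ν'))

end

end StemModel

end

theorem theorem5p1 (I : ℝ → ℝ) (α c θ₀ : ℝ)
    (hI_mono : MonotoneOn I (Set.Ici 0))
    (hI_mem : ∀ y, 0 ≤ y → I y ∈ Set.Icc (0 : ℝ) 1)
    (hα : α ∈ Set.Ioo (0 : ℝ) 1) (hc : 0 < c)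
    (hθ₀ : θ₀ ∈ Set.Ioo 0 (Real.pi / 2)) :
    (∃ θ u : ℝ → ℝ,
      StemModel.IsSolutionOP2 I α c θ₀ θ u ∧
      MeasureTheory.IntegrableOn u (Set.Ioi 0) ∧
      StemModel.IsOptimalLeafMeasure I α c θ₀ θ (StemModel.densityMeasure u) ∧
      (StemModel.planarLeafMeasure θ (StemModel.densityMeasure u)).AbsolutelyContinuous
        (StemModel.arcLength θ)) ∧
    (∀ (θ : ℝ → ℝ) (ν : MeasureTheory.Measure ℝ),
      StemModel.IsOptimalLeafMeasure I α c θ₀ θ ν →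
      (StemModel.planarLeafMeasure θ ν).AbsolutelyContinuous (StemModel.arcLength θ)) := by
  obtain ⟨θ, u, hsol, hu⟩ := StemModel.exists_isSolutionOP2 hα hc hθ₀ hI_mono hI_mem
  exact ⟨⟨θ, u, hsol, hu, hsol.isOptimalLeafMeasure hα.1 hu,
    hsol.angle.planarLeafMeasure_absolutelyContinuous hθ₀
      (StemModel.densityMeasure_restrict_absolutelyContinuous u)⟩,
    fun θ ν h => h.angle.planarLeafMeasure_absolutelyContinuous hθ₀
      (h.restrict_absolutelyContinuous hα.1 hc hθ₀ hI_mem)⟩
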